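/- Let $V$ be a closed (compact, without boundary) connected smooth manifold of dimension $2n+1$ with a cooriented contact structure $\xi=\ker\alpha$, where $\alpha$ is a contact form with Reeb vector field $R_\alpha$. Let $\widetilde{\mathrm{Cont}}_0(V,\xi)$ be the universal cover of the identity component of the group of contactomorphisms of $(V,\xi)$, that is, the group of smooth contact isotopies $\{\phi^t\}_{t\in[0,1]}$ with $\phi^0=\mathrm{id}$, up to homotopy with fixed endpoints, with time-wise composition. For a smooth function $h:[0,1]\times V\to\mathbb{R}$ (a contact Hamiltonian) let $\widetilde\phi_h\in\widetilde{\mathrm{Cont}}_0(V,\xi)$ be the class of the contact isotopy generated by the time-dependent vector field $X_{h_t}$ with $\alpha(X_{h_t})=h_t$ and $d\alpha(X_{h_t},\cdot)=-dh_t+dh_t(R_\alpha)\alpha$; it is autonomous if it does not depend on $t$. Write $\mathrm{id}\preceq\widetilde\phi$ if $\widetilde\phi=\widetilde\phi_h$ for some $h\ge 0$, and $\widetilde\phi\preceq\widetilde\psi$ if $\mathrm{id}\preceq\widetilde\phi^{-1}\widetilde\psi$. Let $\mu:\widetilde{\mathrm{Cont}}_0(V,\xi)\to\mathbb{R}$ be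 a monotone quasi-morphism: $\mu\neq 0$; there is $D>0$ with $|\mu(ab)-\mu(a)-\mu(b)|\le D$ for all $a,b$; $\mu(a^k)=k\mu(a)$ for all $a$ and $k\in\mathbb{Z}$; and $\widetilde\phi\preceq\widetilde\psi$ implies $\mu(\widetilde\phi)\le\mu(\widetilde\psi)$. A closed subset $Y\subset V$ is called $\mu$-subheavy if $\mu(\widetilde\phi_h)=0$ for every autonomous contact Hamiltonian $h$ with $h|_Y=0$, and $\mu$-superheavy if $\mu(\widetilde\phi_h)>0$ for every autonomous contact Hamiltonian $h$ with $h|_Y>0$. Then: (i) every $\mu$-superheavy subset of $V$ is $\mu$-subheavy; (ii) if $Y$ is $\mu$-superheavy and $Z$ is $\mu$-subheavy, then $Y\cap Z\neq\emptyset$. -/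

import Mathlib

open scoped Manifold ContDiff

noncomputable section

/-! ### Contact forms -/

section Forms

variable {d : ℕ} {V : Type*} [TopologicalSpace V] [ChartedSpace (EuclideanSpace ℝ (Fin d)) V]

/-- The coordinate expression, in the preferred chart `c` at `x`, of a 1-form `α` on `V`:
the pullback of `α` under `c⁻¹`, a 1-form on an open subset of `ℝᵈ`. -/
def coordForm (α : ∀ x : V, TangentSpace (𝓡 d) x →L[ℝ] ℝ) (x : V) (y : EuclideanSpace ℝ (Fin d)) :
    EuclideanSpace ℝ (Fin d) →L[ℝ] ℝ :=
  (α ((extChartAt (𝓡 d) x).symm y)).comp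
    (mfderiv 𝓘(ℝ, EuclideanSpace ℝ (Fin d)) (𝓡 d) (extChartAt (𝓡 d) x).symm y)

/-- The exterior derivative `dα (u, v)` of a 1-form at `x`: compute
`D_u' (α' v') - D_v' (α' u')` in the preferred chart at `x`, where `α'`, `u'`, `v'` are the
coordinate expressions of `α`, `u`, `v`. -/
def extDerivForm (α : ∀ x : V, TangentSpace (𝓡 d) x →L[ℝ] ℝ) (x : V)
    (u v : TangentSpace (𝓡 d) x) : ℝ :=
  let D : TangentSpace (𝓡 d) x →L[ℝ] EuclideanSpace ℝ (Fin d) :=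
    mfderiv (𝓡 d) 𝓘(ℝ, EuclideanSpace ℝ (Fin d)) (extChartAt (𝓡 d) x) x
  let L := fderiv ℝ (coordForm α x) (extChartAt (𝓡 d) x x)
  L (D u) (D v) - L (D v) (D u)

/-- A contact form on the `d`-dimensional manifold `V`: a smooth nowhere vanishing 1-form `α` such
that `dα` is nondegenerate on the hyperplane `ker α` at every point. -/
structure ContactForm (d : ℕ) (V : Type*) [TopologicalSpace V]
    [ChartedSpace (EuclideanSpace ℝ (Fin d)) V] [IsManifold (𝓡 d) ∞ V] where
  /-- the underlying 1-form -/
  form : ∀ x : V, TangentSpace (𝓡 d) x →L[ℝ] ℝ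
  smooth : ContMDiff (𝓡 d) ((𝓡 d).prod 𝓘(ℝ, EuclideanSpace ℝ (Fin d) →L[ℝ] ℝ)) ∞
    (fun x => Bundle.TotalSpace.mk' (EuclideanSpace ℝ (Fin d) →L[ℝ] ℝ)
      (E := fun x : V => TangentSpace (𝓡 d) x →L[ℝ] Bundle.Trivial V ℝ x) x (form x))
  ne_zero : ∀ x, form x ≠ 0
  nondegenerate : ∀ x (u : TangentSpace (𝓡 d) x), form x u = 0 →
    (∀ v : TangentSpace (𝓡 d) x, form x v = 0 → extDerivForm form x u v = 0) → u = 0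

variable [IsManifold (𝓡 d) ∞ V]

/-- The contact structure `ξ = ker α`. -/
def ContactForm.ker (α : ContactForm d V) (x : V) : Submodule ℝ (TangentSpace (𝓡 d) x) :=
  LinearMap.ker (α.form x).toLinearMap

/-- `r` is the value at `x` of the Reeb vector field of `α`. -/
def ContactForm.IsReebAt (α : ContactForm d V) (x : V) (r : TangentSpace (𝓡 d) x) : Prop :=
  α.form x r = 1 ∧ ∀ w : TangentSpace (𝓡 d) x, extDerivForm α.form x r w = 0

/-- `v` is the value at `x` of the contact vector field `X` of the function `f`:
`α(X) = f` and `dα(X, ·) = -df + df(R) α`, with `R` the Reeb vector field. -/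
def ContactForm.IsContactVectorAt (α : ContactForm d V) (f : V → ℝ) (x : V)
    (v : TangentSpace (𝓡 d) x) : Prop :=
  let df : TangentSpace (𝓡 d) x →L[ℝ] ℝ := mfderiv (𝓡 d) 𝓘(ℝ, ℝ) f x
  ∃ r : TangentSpace (𝓡 d) x, α.IsReebAt x r ∧ α.form x v = f x ∧
    ∀ w : TangentSpace (𝓡 d) x, extDerivForm α.form x v w = -df w + df r * α.form x w

end Forms

/-! ### Contact isotopies and the universal cover of the identity component -/

section Isotopies

variable {d : ℕ} {V : Type*} [TopologicalSpace V] [ChartedSpace (EuclideanSpace ℝ (Fin d)) V]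
  [IsManifold (𝓡 d) ∞ V]

/-- Smooth families of contactomorphisms of `(V, ξ)` with parameter in the manifold `P`
(possibly with boundary and corners), as a group under pointwise composition. -/
def contactFamily (ξ : ∀ x : V, Submodule ℝ (TangentSpace (𝓡 d) x))
    {F : Type*} [NormedAddCommGroup F] [NormedSpace ℝ F] {K : Type*} [TopologicalSpace K]
    (J : ModelWithCorners ℝ F K) (P : Type*) [TopologicalSpace P] [ChartedSpace K P] :
    Subgroup (P → Equiv.Perm V) where
  carrier := {Φ |
    ContMDiff (J.prod (𝓡 d)) (𝓡 d) ∞ (fun q : P × V => Φ q.1 q.2) ∧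
    ContMDiff (J.prod (𝓡 d)) (𝓡 d) ∞ (fun q : P × V => (Φ q.1)⁻¹ q.2) ∧
    ∀ p x, (ξ x).map (mfderiv (𝓡 d) (𝓡 d) (Φ p) x).toLinearMap = ξ (Φ p x)}
  one_mem' := by
    refine ⟨contMDiff_snd, ?_, fun p x => ?_⟩
    · simpa using! contMDiff_snd
    · have h : mfderiv (𝓡 d) (𝓡 d) (fun y : V => y) x = ContinuousLinearMap.id ℝ _ := mfderiv_id
      change (ξ x).map (mfderiv (𝓡 d) (𝓡 d) (fun y : V => y) x).toLinearMap = ξ x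
      rw [h]
      exact Submodule.map_id _
  mul_mem' := by
    rintro Φ Ψ ⟨h1, h2, h3⟩ ⟨k1, k2, k3⟩
    have hΦ : ∀ p, ContMDiff (𝓡 d) (𝓡 d) ∞ (Φ p) := fun p =>
      h1.comp (contMDiff_const.prodMk contMDiff_id)
    have hΨ : ∀ p, ContMDiff (𝓡 d) (𝓡 d) ∞ (Ψ p) := fun p =>
      k1.comp (contMDiff_const.prodMk contMDiff_id)
    refine ⟨h1.comp (contMDiff_fst.prodMk k1), ?_, fun p x => ?_⟩
    · simpa using! k2.comp (contMDiff_fst.prodMk h2)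
    · change (ξ x).map (mfderiv (𝓡 d) (𝓡 d) (Φ p ∘ Ψ p) x).toLinearMap = ξ (Φ p (Ψ p x))
      rw [mfderiv_comp x ((hΦ p).mdifferentiable (by simp) _) ((hΨ p).mdifferentiable (by simp) _),
        ← h3, ← k3]
      exact Submodule.map_comp _ _ _
  inv_mem' := by
    rintro Φ ⟨h1, h2, h3⟩
    have hΦ : ∀ p, ContMDiff (𝓡 d) (𝓡 d) ∞ (Φ p) := fun p =>
      h1.comp (contMDiff_const.prodMk contMDiff_id)
    have hΨ : ∀ p, ContMDiff (𝓡 d) (𝓡 d) ∞ (⇑(Φ p)⁻¹) := fun p =>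
      h2.comp (contMDiff_const.prodMk contMDiff_id)
    refine ⟨h2, by simpa using! h1, fun p x => ?_⟩
    obtain ⟨y, rfl⟩ := (Φ p).surjective x
    have hy : (Φ p)⁻¹ (Φ p y) = y := by simp
    have hc : mfderiv (𝓡 d) (𝓡 d) (⇑(Φ p)⁻¹ ∘ Φ p) y =
        (mfderiv (𝓡 d) (𝓡 d) (⇑(Φ p)⁻¹) (Φ p y)).comp (mfderiv (𝓡 d) (𝓡 d) (Φ p) y) :=
      mfderiv_comp y ((hΨ p).mdifferentiable (by simp) _) ((hΦ p).mdifferentiable (by simp) _)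
    have hid : ⇑(Φ p)⁻¹ ∘ ⇑(Φ p) = (fun z : V => z) := by
      funext z; simp
    rw [← h3]
    have hm : ((ξ y).map (mfderiv (𝓡 d) (𝓡 d) (Φ p) y).toLinearMap).map
        (mfderiv (𝓡 d) (𝓡 d) (⇑(Φ p)⁻¹) (Φ p y)).toLinearMap =
        (ξ y).map (mfderiv (𝓡 d) (𝓡 d) (⇑(Φ p)⁻¹ ∘ Φ p) y).toLinearMap := by
      rw [hc]; exact (Submodule.map_comp _ _ _).symm
    have hi : mfderiv (𝓡 d) (𝓡 d) (fun z : V => z) y = ContinuousLinearMap.id ℝ _ := mfderiv_id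
    refine hm.trans ?_
    change _ = ξ ((Φ p)⁻¹ (Φ p y))
    rw [hid, hi, hy]
    exact Submodule.map_id _

/-- Contact isotopies `{φ_t}`, `t ∈ [0,1]`, based at the identity, as a group under time-wise
composition. -/
def contactIsotopy (ξ : ∀ x : V, Submodule ℝ (TangentSpace (𝓡 d) x)) :
    Subgroup (unitInterval → Equiv.Perm V) :=
  contactFamily ξ (𝓡∂ 1) unitInterval ⊓ (Pi.evalMonoidHom (fun _ => Equiv.Perm V) 0).ker

/-- The contractible loops: contact isotopies `{φ_t}` from the identity to the identity which are
homotopic to the constant isotopy through a smooth family of contactomorphisms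
`Φ (s, t)`, with endpoints (`t = 0` and `t = 1`) fixed. -/
def contractibleLoops (ξ : ∀ x : V, Submodule ℝ (TangentSpace (𝓡 d) x)) :
    Subgroup (contactIsotopy ξ) where
  carrier := {φ | ∃ Φ ∈ contactFamily ξ ((𝓡∂ 1).prod (𝓡∂ 1)) (unitInterval × unitInterval),
    (∀ s, Φ (s, 0) = 1) ∧ (∀ s, Φ (s, 1) = 1) ∧
    (∀ t, Φ (0, t) = 1) ∧ (∀ t, Φ (1, t) = φ.1 t)}
  one_mem' := ⟨1, one_mem _, by simp⟩
  mul_mem' := by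
    rintro φ ψ ⟨Φ, h, h0, h1, h2, h3⟩ ⟨Ψ, k, k0, k1, k2, k3⟩
    exact ⟨Φ * Ψ, mul_mem h k, by simp [h0, k0], by simp [h1, k1], by simp [h2, k2],
      by simp [h3, k3]⟩
  inv_mem' := by
    rintro φ ⟨Φ, h, h0, h1, h2, h3⟩
    exact ⟨Φ⁻¹, inv_mem h, by simp [h0], by simp [h1], by simp [h2], by simp [h3]⟩

instance contractibleLoops_normal (ξ : ∀ x : V, Submodule ℝ (TangentSpace (𝓡 d) x)) :
    (contractibleLoops ξ).Normal where
  conj_mem := by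
    rintro φ ⟨Φ, h, h0, h1, h2, h3⟩ ψ
    have hψ := ψ.2.1
    have k : (fun q : unitInterval × unitInterval => ψ.1 q.2) ∈
        contactFamily ξ ((𝓡∂ 1).prod (𝓡∂ 1)) (unitInterval × unitInterval) :=
      ⟨hψ.1.comp ((contMDiff_snd.comp contMDiff_fst).prodMk contMDiff_snd),
        hψ.2.1.comp ((contMDiff_snd.comp contMDiff_fst).prodMk contMDiff_snd),
        fun p x => hψ.2.2 p.2 x⟩
    exact ⟨_, mul_mem (mul_mem k h) (inv_mem k), by simp [h0], by simp [h1],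
      by simp [h2], by simp [h3]⟩

/-- The universal cover of the identity component of the contactomorphism group of `(V, ξ)`:
contact isotopies based at the identity, up to homotopy with fixed endpoints. (Two isotopies
`φ`, `ψ` are homotopic with fixed endpoints exactly when the loop `φ⁻¹ψ` is contractible.) -/
abbrev ContTilde (ξ : ∀ x : V, Submodule ℝ (TangentSpace (𝓡 d) x)) : Type _ :=
  contactIsotopy ξ ⧸ contractibleLoops ξ

/-- The velocity `(d/dt) φ_t(x)` of an isotopy at time `t`, a tangent vector at `φ_t(x)`. -/
def isotopyVelocity (φ : unitInterval → Equiv.Perm V) (t : unitInterval) (x : V) :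
    TangentSpace (𝓡 d) (φ t x) :=
  mfderiv (𝓡∂ 1) (𝓡 d) (fun s => φ s x) t (1 : TangentSpace (𝓡∂ 1) t)

/-- The isotopy `φ` is generated by the contact Hamiltonian `h` on `[0,1] × V`: it integrates the
time-dependent contact vector field of `h`. -/
def ContactForm.Generates (α : ContactForm d V) (h : unitInterval → V → ℝ)
    (φ : contactIsotopy α.ker) : Prop :=
  ∀ t x, α.IsContactVectorAt (h t) (φ.1 t x) (isotopyVelocity φ.1 t x)

/-- `α.Represents h a`: the element `a` of the universal cover is the one generated by the
contact Hamiltonian `h` (which exists and is unique on a closed manifold if `h` is smooth). -/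
def ContactForm.Represents (α : ContactForm d V) (h : unitInterval → V → ℝ)
    (a : ContTilde α.ker) : Prop :=
  ∃ φ : contactIsotopy α.ker, α.Generates h φ ∧ (φ : ContTilde α.ker) = a

/-- `id ⪯ a`: the element `a` is generated by a smooth nonnegative contact Hamiltonian. -/
def ContactForm.IsNonneg (α : ContactForm d V) (a : ContTilde α.ker) : Prop :=
  ∃ h : unitInterval → V → ℝ,
    ContMDiff ((𝓡∂ 1).prod (𝓡 d)) 𝓘(ℝ, ℝ) ∞ (fun q : unitInterval × V => h q.1 q.2) ∧
    (∀ t x, 0 ≤ h t x) ∧ α.Represents h a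

/-- The relation `a ⪯ b` if and only if `id ⪯ a⁻¹ b`. -/
def ContactForm.Preceq (α : ContactForm d V) (a b : ContTilde α.ker) : Prop :=
  α.IsNonneg (a⁻¹ * b)

end Isotopies

/-! ### Quasi-morphisms, subheavy and superheavy sets -/

/-- A quasi-morphism, in the convention that these are homogeneous and nonzero. -/
structure IsQuasiMorphism {G : Type*} [Group G] (μ : G → ℝ) : Prop where
  bounded_defect : ∃ D : ℝ, 0 < D ∧ ∀ a b : G, |μ (a * b) - μ a - μ b| ≤ D
  homogeneous : ∀ (a : G) (k : ℤ), μ (a ^ k) = k * μ a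
  ne_zero : μ ≠ 0

section Heavy

variable {d : ℕ} {V : Type*} [TopologicalSpace V] [ChartedSpace (EuclideanSpace ℝ (Fin d)) V]
  [IsManifold (𝓡 d) ∞ V]

/-- `μ` is monotone for the relation `⪯`. -/
def ContactForm.IsMonotone (α : ContactForm d V) (μ : ContTilde α.ker → ℝ) : Prop :=
  ∀ a b : ContTilde α.ker, α.Preceq a b → μ a ≤ μ b

/-- A closed subset `Y` is `μ`-subheavy if `μ` vanishes on the element generated by any autonomous
contact Hamiltonian that vanishes on `Y`. -/
def ContactForm.IsSubheavy (α : ContactForm d V) (μ : ContTilde α.ker → ℝ) (Y : Set V) : Prop :=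
  IsClosed Y ∧ ∀ h : V → ℝ, ContMDiff (𝓡 d) 𝓘(ℝ, ℝ) ∞ h → (∀ y ∈ Y, h y = 0) →
    ∀ a : ContTilde α.ker, α.Represents (fun _ => h) a → μ a = 0

/-- A closed subset `Y` is `μ`-superheavy if `μ` is positive on the element generated by any
autonomous contact Hamiltonian that is positive on `Y`. -/
def ContactForm.IsSuperheavy (α : ContactForm d V) (μ : ContTilde α.ker → ℝ) (Y : Set V) : Prop :=
  IsClosed Y ∧ ∀ h : V → ℝ, ContMDiff (𝓡 d) 𝓘(ℝ, ℝ) ∞ h → (∀ y ∈ Y, 0 < h y) →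
    ∀ a : ContTilde α.ker, α.Represents (fun _ => h) a → 0 < μ a

end Heavy

end

/-!
# Superheavy and subheavy subsets of contact manifolds

The starting point is that every contact isotopy `φ` has a contact Hamiltonian,
`h_t (φ_t x) = α(dφ_t(x)/dt)`, and integrates its contact vector field
(`contactIsotopy.generates_hamiltonian`). If `φ_t^* α = λ_t α`, then the isotopy `φ⁻¹ ψ` has the
Hamiltonian `λ⁻¹ (g - f) ∘ φ_t`, where `f` and `g` are the Hamiltonians of `φ` and `ψ`
(`contactIsotopy.hamiltonian_inv_mul`). Hence `f ≤ g` implies `μ(φ) ≤ μ(ψ)`; in particular `μ`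
depends only on the Hamiltonian. Conversely a smooth function on a closed manifold generates a
contact isotopy, the flow of its contact vector field
(`ContactForm.exists_contactIsotopy_zpow_hamiltonian`).

Superheavy sets are subheavy: let `h` vanish on the superheavy set `Y` and let `φ` be its flow. For
every integer `k` the power `φ^k` is the flow of `k h`. Let `δ > 0` be the minimum of its conformal
factor and `ψ` the flow of `k h + δ`, a function positive on `Y`, so that `μ(ψ) > 0`. The
Hamiltonian of `φ^{-k} ψ` is `δ / λ ≤ 1`, so `μ(φ^{-k} ψ)` is at most the value of `μ` on the flow
of the constant function `1`. As `μ` is a homogeneous quasi-morphism, `k μ(φ)` is bounded below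
uniformly in `k ∈ ℤ`, which forces `μ(φ) = 0`. That a superheavy set meets every subheavy set is
then seen on a smooth function equal to `1` on the first and `0` on the second.

The differential geometry behind this is built here. Smoothness of flows rests on the smooth
dependence of solutions of ordinary differential equations on initial values, obtained from the
implicit function theorem for the Volterra equation in the space of continuous curves. That an
isotopy integrates its contact vector field, and that flows preserve `ξ`, both follow from Cartan's
formula `d/dt (φ_t^* α) = φ_t^* (dα(X_t, ·)) + d(α(X_t) ∘ φ_t)`, where `X_t` is the velocity
(`ContactForm.hasDerivWithinAt_form_mfderiv`); it is the identity `F^* dα = d (F^* α)` for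
`F (t, x) = φ_t(x)`, and that in turn is the symmetry of second derivatives.
-/

open scoped Topology
open Set Filter MeasureTheory

/-! ### Superposition operators on spaces of continuous functions -/

section Superposition

variable {K : Type*} [TopologicalSpace K] [CompactSpace K]

/-- Pointwise application `(A, η) ↦ (k ↦ A k (η k))` as a continuous bilinear map. -/
noncomputable def ContinuousMap.clmApplyCLM (K : Type*) [TopologicalSpace K] [CompactSpace K]
    (E F : Type*) [NormedAddCommGroup E] [NormedSpace ℝ E] [NormedAddCommGroup F]
    [NormedSpace ℝ F] : C(K, E →L[ℝ] F) →L[ℝ] C(K, E) →L[ℝ] C(K, F) :=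
  LinearMap.mkContinuous₂
    (LinearMap.mk₂ ℝ (fun (A : C(K, E →L[ℝ] F)) (η : C(K, E)) =>
        (⟨fun k => A k (η k), by fun_prop⟩ : C(K, F)))
      (fun _ _ _ => by ext; simp) (fun _ _ _ => by ext; simp)
      (fun _ _ _ => by ext; simp) (fun _ _ _ => by ext; simp)) 1
    (fun A η => by
      rw [ContinuousMap.norm_le _ (by positivity)]
      intro k
      have h : ‖A k (η k)‖ ≤ ‖A‖ * ‖η‖ :=
        ((A k).le_opNorm _).trans
          (mul_le_mul (A.norm_coe_le_norm k) (η.norm_coe_le_norm k) (norm_nonneg _)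
            (norm_nonneg A))
      simpa using h)

universe u

variable {E F : Type u} [NormedAddCommGroup E] [NormedSpace ℝ E] [NormedAddCommGroup F]
  [NormedSpace ℝ F]

/-- The superposition operator `γ ↦ f ∘ γ` of a `C¹` map is differentiable in the sup norm, with
derivative `η ↦ (f' ∘ γ) η`. -/
theorem hasFDerivAt_comp_left {f : E → F} (hf : Continuous f) {f' : E → E →L[ℝ] F}
    (hf' : Continuous f') (hd : ∀ x, HasFDerivAt f (f' x) x) (γ : C(K, E)) :
    HasFDerivAt (fun γ : C(K, E) => (⟨f, hf⟩ : C(E, F)).comp γ)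
      (ContinuousMap.clmApplyCLM K E F ((⟨f', hf'⟩ : C(E, E →L[ℝ] F)).comp γ)) γ := by
  rw [hasFDerivAt_iff_isLittleO_nhds_zero, Asymptotics.isLittleO_iff]
  intro ε hε
  have hc : ContinuousAt (fun γ : C(K, E) => (⟨f', hf'⟩ : C(E, E →L[ℝ] F)).comp γ) γ :=
    (ContinuousMap.continuous_postcomp _).continuousAt
  obtain ⟨δ, hδ, h⟩ := (Metric.continuousAt_iff (α := C(K, E)) (β := C(K, E →L[ℝ] F))).1 hc ε hε
  filter_upwards [Metric.ball_mem_nhds (0 : C(K, E)) hδ] with η hη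
  rw [ContinuousMap.norm_le _ (by positivity)]
  intro k
  have hk : ‖η k‖ < δ := (η.norm_coe_le_norm k).trans_lt (by simpa using hη)
  have key : ∀ y ∈ Metric.ball (γ k) δ, ‖f' y - f' (γ k)‖ ≤ ε := by
    intro y hy
    have h1 := @h (γ + ContinuousMap.const K (y - γ k)) (by
      rw [dist_eq_norm, add_sub_cancel_left]
      refine (ContinuousMap.norm_lt_iff _ hδ).2 fun _ => ?_
      simpa [dist_eq_norm] using hy)
    have h2 := (ContinuousMap.dist_apply_le_dist k).trans h1.le
    simpa [dist_eq_norm] using h2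
  have hmv := (convex_ball (γ k) δ).norm_image_sub_le_of_norm_hasFDerivWithin_le'
    (f := f) (f' := f') (φ := f' (γ k)) (C := ε) (x := γ k) (y := γ k + η k)
    (fun y _ => (hd y).hasFDerivWithinAt) key (Metric.mem_ball_self hδ) (by simpa using hk)
  rw [add_sub_cancel_left] at hmv
  refine le_trans ?_ (hmv.trans (mul_le_mul_of_nonneg_left (η.norm_coe_le_norm k) hε.le))
  simp [ContinuousMap.clmApplyCLM]

/-- The superposition operator `γ ↦ f ∘ γ` of a `Cⁿ` map is `Cⁿ` in the sup norm. -/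
theorem contDiff_comp_left (n : ℕ) : ∀ {F : Type u} [NormedAddCommGroup F] [NormedSpace ℝ F]
    {f : E → F} (hf : Continuous f), ContDiff ℝ n f →
    ContDiff ℝ n (fun γ : C(K, E) => (⟨f, hf⟩ : C(E, F)).comp γ) := by
  induction n with
  | zero =>
    intro F _ _ f hf _
    exact contDiff_zero.2 (ContinuousMap.continuous_postcomp _)
  | succ n ih =>
    intro F _ _ f hf h
    have h' := (contDiff_succ_iff_fderiv (n := n)).1 (by exact_mod_cast h)
    have hf' : Continuous (fderiv ℝ f) := h'.2.2.continuous
    have hder := hasFDerivAt_comp_left (K := K) hf hf' fun x => (h'.1 x).hasFDerivAt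
    refine (contDiff_succ_iff_fderiv (n := n)).2
      ⟨fun γ => (hder γ).differentiableAt, by simp, ?_⟩
    rw [funext fun γ => (hder γ).fderiv]
    exact (ContinuousMap.clmApplyCLM K E F).contDiff.comp (ih hf' h'.2.2)

end Superposition

/-! ### Smooth dependence of solutions of differential equations on the initial value -/

section Local

variable {E : Type} [NormedAddCommGroup E] [NormedSpace ℝ E]

/-- The Volterra operator `η ↦ (r ↦ ∫₀ʳ η)` on continuous curves `[-2, 2] → E`. -/
noncomputable def volterra (E : Type) [NormedAddCommGroup E] [NormedSpace ℝ E] :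
    C(Icc (-2 : ℝ) 2, E) →L[ℝ] C(Icc (-2 : ℝ) 2, E) :=
  LinearMap.mkContinuous
    { toFun := fun η =>
        ⟨fun r => ∫ τ in (0 : ℝ)..r, η (projIcc (-2) 2 (by norm_num) τ), by
          have hc : Continuous fun τ => η (projIcc (-2) 2 (by norm_num) τ) := by fun_prop
          exact (intervalIntegral.continuous_primitive (fun a b => hc.intervalIntegrable a b)
            0).comp continuous_subtype_val⟩
      map_add' := fun η ζ => by
        ext r
        have hc (η : C(Icc (-2 : ℝ) 2, E)) :
          Continuous fun τ => η (projIcc (-2) 2 (by norm_num) τ) := by fun_prop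
        exact intervalIntegral.integral_add ((hc η).intervalIntegrable _ _)
          ((hc ζ).intervalIntegrable _ _)
      map_smul' := fun a η => by
        ext r
        exact intervalIntegral.integral_smul _ _ } 2
    (fun η => by
      rw [ContinuousMap.norm_le _ (by positivity)]
      intro r
      refine (intervalIntegral.norm_integral_le_of_norm_le_const
        (fun τ _ => η.norm_coe_le_norm _)).trans ?_
      rw [mul_comm]
      refine mul_le_mul_of_nonneg_right ?_ (norm_nonneg _)
      rw [sub_zero, abs_le]
      exact r.2)

theorem hasDerivAt_volterra [CompleteSpace E] (η : C(Icc (-2 : ℝ) 2, E)) (r : ℝ)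
    (hr : r ∈ Ioo (-2 : ℝ) 2) :
    HasDerivAt (fun r => volterra E η (projIcc (-2) 2 (by norm_num) r))
      (η (projIcc (-2) 2 (by norm_num) r)) r := by
  have hc : Continuous fun τ => η (projIcc (-2) 2 (by norm_num) τ) := by fun_prop
  refine (intervalIntegral.integral_hasDerivAt_right (hc.intervalIntegrable 0 r)
    (hc.stronglyMeasurableAtFilter _ _) hc.continuousAt).congr_of_eventuallyEq ?_
  filter_upwards [Ioo_mem_nhds hr.1 hr.2] with s hs
  simp [volterra, projIcc_of_mem _ (Ioo_subset_Icc_self hs)]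

/-- Solutions of `γ' = s f(γ)`, `γ(0) = x` on `[-2, 2]` exist for `(s, x)` near `(0, x₀)` and form
a `Cⁿ` family of curves: they are the zeros of `γ - x - s ∫ f(γ)`, to which the implicit function
theorem in the Banach space of curves applies, as the derivative in `γ` at `s = 0` is the
identity. The parameter `s` rescales time, so that smoothness in `(s, x)` at a fixed time
contains smoothness in time. -/
theorem exists_contDiffAt_solution [CompleteSpace E] {f : E → E} (hf : ContDiff ℝ ∞ f) (x₀ : E)
    (n : ℕ) :
    ∃ ψ : ℝ × E → C(Icc (-2 : ℝ) 2, E), ContDiffAt ℝ (n + 1) ψ (0, x₀) ∧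
      ψ (0, x₀) = ContinuousMap.const _ x₀ ∧
      ∀ᶠ p in 𝓝 ((0 : ℝ), x₀), ψ p ⟨0, by norm_num⟩ = p.2 ∧
        ∀ r ∈ Ioo (-2 : ℝ) 2, HasDerivAt (fun r => ψ p (projIcc (-2) 2 (by norm_num) r))
          (p.1 • f (ψ p (projIcc (-2) 2 (by norm_num) r))) r := by
  let c : E →L[ℝ] C(Icc (-2 : ℝ) 2, E) := ContinuousLinearMap.const ℝ _
  let N : C(Icc (-2 : ℝ) 2, E) → C(Icc (-2 : ℝ) 2, E) :=
    fun γ => (⟨f, hf.continuous⟩ : C(E, E)).comp γ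
  let G : (ℝ × E) × C(Icc (-2 : ℝ) 2, E) → C(Icc (-2 : ℝ) 2, E) :=
    fun q => q.2 - c q.1.2 - q.1.1 • volterra E (N q.2)
  have hN : ContDiff ℝ (n + 1 : ℕ) N :=
    contDiff_comp_left (n + 1) hf.continuous (hf.of_le (by exact_mod_cast le_top))
  have hG : ContDiff ℝ (n + 1 : ℕ) G := by
    have h1 : ContDiff ℝ (n + 1 : ℕ)
        (fun q : (ℝ × E) × C(Icc (-2 : ℝ) 2, E) => volterra E (N q.2)) :=
      (volterra E).contDiff.comp (hN.comp contDiff_snd)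
    have h2 : ContDiff ℝ (n + 1 : ℕ)
        (fun q : (ℝ × E) × C(Icc (-2 : ℝ) 2, E) => c q.1.2) :=
      c.contDiff.comp (contDiff_snd.comp contDiff_fst)
    exact (contDiff_snd.sub h2).sub ((contDiff_fst.comp contDiff_fst).smul h1)
  let u : (ℝ × E) × C(Icc (-2 : ℝ) 2, E) := ((0, x₀), c x₀)
  have hGu : G u = 0 := by simp [G, u]
  have hn : ((n + 1 : ℕ) : WithTop ℕ∞) ≠ 0 := by exact_mod_cast n.succ_ne_zero
  have hinv : fderiv ℝ G u ∘L .inr ℝ (ℝ × E) C(Icc (-2 : ℝ) 2, E) =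
      ContinuousLinearMap.id ℝ _ := by
    have h1 : HasFDerivAt (fun γ => G ((0, x₀), γ))
        (fderiv ℝ G u ∘L .inr ℝ (ℝ × E) C(Icc (-2 : ℝ) 2, E)) (c x₀) :=
      ((hG.differentiable hn) u).hasFDerivAt.comp (c x₀) (hasFDerivAt_prodMk_right _ _)
    have h2 : HasFDerivAt (fun γ => G ((0, x₀), γ)) (ContinuousLinearMap.id ℝ _) (c x₀) := by
      simpa [G] using (hasFDerivAt_id (𝕜 := ℝ) (c x₀)).sub_const (c x₀)
    exact h1.unique h2
  have hinv' : (fderiv ℝ G u ∘L .inr ℝ (ℝ × E) C(Icc (-2 : ℝ) 2, E)).IsInvertible := by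
    rw [hinv]; exact ContinuousLinearMap.isInvertible_equiv (f := .refl ℝ _)
  have hGa : ContDiffAt ℝ (n + 1 : ℕ) G u := hG.contDiffAt
  refine ⟨hGa.implicitFunction hn hinv', ?_, hGa.implicitFunction_apply_self hn hinv', ?_⟩
  · exact_mod_cast hGa.contDiffAt_implicitFunction hn hinv'
  filter_upwards [hGa.eventually_apply_implicitFunction hn hinv'] with p hp
  set γ := hGa.implicitFunction hn hinv' p with hγ
  have heq : γ = c p.2 + p.1 • volterra E (N γ) := by
    rw [hGu] at hp
    have h3 : γ - c p.2 - p.1 • volterra E (N γ) = 0 := hp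
    rw [sub_sub, sub_eq_zero] at h3
    exact h3
  refine ⟨?_, fun r hr => ?_⟩
  · rw [heq]
    simp [c, volterra]
  · have h4 := ((hasDerivAt_volterra (N γ) r hr).const_smul p.1).const_add p.2
    refine h4.congr_of_eventuallyEq (Eventually.of_forall fun s => ?_)
    change γ _ = _
    conv_lhs => rw [heq]
    simp [c]

end Local

/-! ### Vector fields and curves in a chart -/

section ChartFields

variable {E : Type} [NormedAddCommGroup E] [NormedSpace ℝ E]
  {V : Type*} [TopologicalSpace V] [ChartedSpace E V] [IsManifold 𝓘(ℝ, E) ∞ V]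

/-- A vector field is smooth at `x` if and only if its coordinate expression, in a chart around
`x`, is smooth at `x`. -/
theorem contMDiffAt_vectorField_iff {X : ∀ x : V, TangentSpace 𝓘(ℝ, E) x} {x₀ x : V}
    (hx : x ∈ (extChartAt 𝓘(ℝ, E) x₀).source) {n : ℕ∞} :
    ContMDiffAt 𝓘(ℝ, E) 𝓘(ℝ, E).tangent n (fun x => (⟨x, X x⟩ : TangentBundle 𝓘(ℝ, E) V)) x ↔
      ContMDiffAt 𝓘(ℝ, E) 𝓘(ℝ, E) n
        (fun x => (mfderiv 𝓘(ℝ, E) 𝓘(ℝ, E) (extChartAt 𝓘(ℝ, E) x₀) x (X x) : E)) x := by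
  have : IsManifold 𝓘(ℝ, E) (n + 1) V := .of_le (n := ∞) (by exact_mod_cast le_top)
  rw [extChartAt_source] at hx
  have hb : x ∈ (trivializationAt E (TangentSpace 𝓘(ℝ, E)) x₀).baseSet := by simpa using hx
  have h1 := (trivializationAt E (TangentSpace 𝓘(ℝ, E)) x₀).contMDiffAt_section_iff
    (IB := 𝓘(ℝ, E)) (n := n) (s := X) hb
  refine h1.trans (EventuallyEq.contMDiffAt_iff ?_)
  filter_upwards [(chartAt E x₀).open_source.mem_nhds hx] with y hy
  refine Eq.trans ?_
    (DFunLike.congr_fun (TangentBundle.continuousLinearMapAt_trivializationAt hy) (X y))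
  rw [Bundle.Trivialization.continuousLinearMapAt_apply,
    Bundle.Trivialization.linearMapAt_def_of_mem _ (by simpa using hy)]
  rfl

theorem mfderiv_extChartAt_symm_apply_mfderiv {x₀ x : V}
    (hx : x ∈ (extChartAt 𝓘(ℝ, E) x₀).source) (v : TangentSpace 𝓘(ℝ, E) x) :
    mfderiv 𝓘(ℝ, E) 𝓘(ℝ, E) (extChartAt 𝓘(ℝ, E) x₀).symm (extChartAt 𝓘(ℝ, E) x₀ x)
      (mfderiv 𝓘(ℝ, E) 𝓘(ℝ, E) (extChartAt 𝓘(ℝ, E) x₀) x v) = v := by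
  have h := mfderivWithin_extChartAt_symm_comp_mfderiv_extChartAt' (I := 𝓘(ℝ, E)) hx
  simp only [modelWithCornersSelf_coe, range_id, mfderivWithin_univ] at h
  exact congrArg (fun A => A v) h

theorem mfderiv_extChartAt_apply_mfderiv_symm {x₀ : V} {y : E}
    (hy : y ∈ (extChartAt 𝓘(ℝ, E) x₀).target) (v : E) :
    mfderiv 𝓘(ℝ, E) 𝓘(ℝ, E) (extChartAt 𝓘(ℝ, E) x₀) ((extChartAt 𝓘(ℝ, E) x₀).symm y)
      (mfderiv 𝓘(ℝ, E) 𝓘(ℝ, E) (extChartAt 𝓘(ℝ, E) x₀).symm y v) = v := by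
  have h := mfderiv_extChartAt_comp_mfderivWithin_extChartAt_symm (I := 𝓘(ℝ, E)) hy
  simp only [modelWithCornersSelf_coe, range_id, mfderivWithin_univ] at h
  exact congrArg (fun A => A v) h

/-- The coordinate expression of a vector field in the chart at `x₀`. -/
noncomputable def coordField (X : ∀ x : V, TangentSpace 𝓘(ℝ, E) x) (x₀ : V) (y : E) : E :=
  mfderiv 𝓘(ℝ, E) 𝓘(ℝ, E) (extChartAt 𝓘(ℝ, E) x₀) ((extChartAt 𝓘(ℝ, E) x₀).symm y)
    (X ((extChartAt 𝓘(ℝ, E) x₀).symm y))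

theorem contDiffOn_coordField {X : ∀ x : V, TangentSpace 𝓘(ℝ, E) x}
    (hX : ContMDiff 𝓘(ℝ, E) 𝓘(ℝ, E).tangent ∞
      (fun x => (⟨x, X x⟩ : TangentBundle 𝓘(ℝ, E) V))) (x₀ : V) :
    ContDiffOn ℝ ∞ (coordField X x₀) (extChartAt 𝓘(ℝ, E) x₀).target := by
  rw [← contMDiffOn_iff_contDiffOn]
  intro y hy
  have hx := (extChartAt 𝓘(ℝ, E) x₀).map_target hy
  have h1 := (contMDiffAt_vectorField_iff (n := ⊤) hx).1 (hX _)
  exact h1.comp_contMDiffWithinAt y (contMDiffOn_extChartAt_symm x₀ y hy)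

/-- A function smooth on a neighbourhood of `y₀` agrees near `y₀` with a globally smooth one. -/
theorem exists_contDiff_eventuallyEq [FiniteDimensional ℝ E] {F : Type*} [NormedAddCommGroup F]
    [NormedSpace ℝ F] {g : E → F} {T : Set E} (hT : IsOpen T) (hg : ContDiffOn ℝ ∞ g T) {y₀ : E}
    (hy : y₀ ∈ T) : ∃ f : E → F, ContDiff ℝ ∞ f ∧ f =ᶠ[𝓝 y₀] g := by
  obtain ⟨r, hr, hrT⟩ := Metric.isOpen_iff.1 hT y₀ hy
  let b : ContDiffBump y₀ := ⟨r / 3, r / 2, by positivity, by linarith⟩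
  refine ⟨fun y => b y • g y, contDiff_iff_contDiffAt.2 fun y => ?_, ?_⟩
  · by_cases h : y ∈ T
    · exact b.contDiffAt.smul (hg.contDiffAt (hT.mem_nhds h))
    · have hc : y ∈ (tsupport b)ᶜ := fun hy' => h (hrT (by
        rw [b.tsupport_eq] at hy'
        exact Metric.closedBall_subset_ball (by simp only [b]; linarith) hy'))
      refine (contDiffAt_const (c := (0 : F))).congr_of_eventuallyEq ?_
      filter_upwards [(isClosed_tsupport b).isOpen_compl.mem_nhds hc] with z hz
      rw [image_eq_zero_of_notMem_tsupport hz, zero_smul]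
  · filter_upwards [b.eventuallyEq_one] with y hy
    rw [hy, Pi.one_apply, one_smul]

/-- A curve in `E` which solves the coordinate equation of `s X` gives an integral curve of
`s X`. -/
theorem hasMFDerivAt_extChartAt_symm_comp {X : ∀ x : V, TangentSpace 𝓘(ℝ, E) x} {x₀ : V}
    {β : ℝ → E} {r s : ℝ} (hr : β r ∈ (extChartAt 𝓘(ℝ, E) x₀).target)
    (hβ : HasDerivAt β (s • coordField X x₀ (β r)) r) :
    HasMFDerivAt 𝓘(ℝ, ℝ) 𝓘(ℝ, E) (fun r => (extChartAt 𝓘(ℝ, E) x₀).symm (β r)) r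
      ((1 : ℝ →L[ℝ] ℝ).smulRight ((s • X) ((extChartAt 𝓘(ℝ, E) x₀).symm (β r)))) := by
  have h1 : MDifferentiableAt 𝓘(ℝ, E) 𝓘(ℝ, E) (extChartAt 𝓘(ℝ, E) x₀).symm (β r) :=
    ((contMDiffOn_extChartAt_symm (n := ∞) x₀).contMDiffAt
      ((isOpen_extChartAt_target x₀).mem_nhds hr)).mdifferentiableAt (by simp)
  refine (h1.hasMFDerivAt.comp r hβ.hasFDerivAt.hasMFDerivAt).congr_mfderiv ?_
  ext
  have hx := (extChartAt 𝓘(ℝ, E) x₀).map_target hr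
  have h2 := mfderiv_extChartAt_symm_apply_mfderiv hx (X ((extChartAt 𝓘(ℝ, E) x₀).symm (β r)))
  rw [(extChartAt 𝓘(ℝ, E) x₀).right_inv hr] at h2
  have h3 := congrArg (fun v => s • v) h2
  rw [← map_smul] at h3
  refine Eq.trans ?_ (h3.trans (one_smul ℝ _).symm)
  change mfderiv 𝓘(ℝ, E) 𝓘(ℝ, E) (extChartAt 𝓘(ℝ, E) x₀).symm (β r)
    ((1 : ℝ) • (s • coordField X x₀ (β r))) = _
  rw [one_smul]
  rfl

end ChartFields

/-! ### Flows of vector fields on closed manifolds -/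

section Flow

variable {E : Type} [NormedAddCommGroup E] [NormedSpace ℝ E] [FiniteDimensional ℝ E]
  {V : Type*} [TopologicalSpace V] [ChartedSpace E V] [IsManifold 𝓘(ℝ, E) ∞ V]

/-- For `(s, x)` near `(0, x₀)` the field `s X` has an integral curve on `(-2, 2)` which starts at
`x`, and whose value at time `1` depends on `(s, x)` in a `Cⁿ` fashion. -/
theorem exists_local_flow {X : ∀ x : V, TangentSpace 𝓘(ℝ, E) x}
    (hX : ContMDiff 𝓘(ℝ, E) 𝓘(ℝ, E).tangent ∞
      (fun x => (⟨x, X x⟩ : TangentBundle 𝓘(ℝ, E) V))) (x₀ : V) (n : ℕ) :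
    ∃ Φ : ℝ × V → V, ContMDiffAt (𝓘(ℝ, ℝ).prod 𝓘(ℝ, E)) 𝓘(ℝ, E) n Φ (0, x₀) ∧
      ∀ᶠ p in 𝓝 ((0 : ℝ), x₀), ∃ γ : ℝ → V, γ 0 = p.2 ∧ γ 1 = Φ p ∧
        IsMIntegralCurveOn γ (p.1 • X) (Ioo (-2) 2) := by
  have : CompleteSpace E := FiniteDimensional.complete ℝ E
  set c := extChartAt 𝓘(ℝ, E) x₀ with hc
  have hT : IsOpen c.target := isOpen_extChartAt_target x₀
  obtain ⟨f, hf, hfX⟩ := exists_contDiff_eventuallyEq hT (contDiffOn_coordField hX x₀)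
    (mem_extChartAt_target x₀)
  obtain ⟨ψ, hψ, hψ0, hψs⟩ := exists_contDiffAt_solution hf (c x₀) n
  obtain ⟨ρ, hρ, hball⟩ := Metric.mem_nhds_iff.1 (hfX.and (hT.mem_nhds (mem_extChartAt_target x₀)))
  have hcs : ContMDiffAt 𝓘(ℝ, E) 𝓘(ℝ, E) n c x₀ := contMDiffAt_extChartAt
  have hι : ContMDiffAt (𝓘(ℝ, ℝ).prod 𝓘(ℝ, E)) 𝓘(ℝ, ℝ × E) n
      (fun p : ℝ × V => (p.1, c p.2)) (0, x₀) :=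
    contMDiffAt_fst.prodMk_space (hcs.comp ((0 : ℝ), x₀) contMDiffAt_snd)
  have hone : (1 : ℝ) ∈ Icc (-2 : ℝ) 2 := by norm_num
  refine ⟨fun p => c.symm (ψ (p.1, c p.2) ⟨1, hone⟩), ?_, ?_⟩
  · have h1 : ContMDiffAt (𝓘(ℝ, ℝ).prod 𝓘(ℝ, E)) 𝓘(ℝ, E) n
        (fun p : ℝ × V => ψ (p.1, c p.2) ⟨1, hone⟩) (0, x₀) := by
      have h2 : ContDiffAt ℝ n (fun q => ψ q ⟨1, hone⟩) (0, c x₀) :=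
        ((ContinuousMap.evalCLM ℝ (⟨1, hone⟩ : Icc (-2 : ℝ) 2)).contDiff.contDiffAt.comp _
          hψ).of_le (by exact_mod_cast Nat.le_succ n)
      exact h2.contMDiffAt.comp ((0 : ℝ), x₀) hι
    have h3 : ContMDiffAt 𝓘(ℝ, E) 𝓘(ℝ, E) n c.symm (ψ (0, c x₀) ⟨1, hone⟩) := by
      rw [hψ0]
      exact (contMDiffOn_extChartAt_symm x₀).contMDiffAt (hT.mem_nhds (mem_extChartAt_target x₀))
    exact h3.comp ((0 : ℝ), x₀) h1
  · have hnear : ∀ᶠ q in 𝓝 ((0 : ℝ), c x₀), ∀ k, ψ q k ∈ Metric.ball (c x₀) ρ := by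
      have h4 : Tendsto ψ (𝓝 (0, c x₀)) (𝓝 (ContinuousMap.const _ (c x₀))) := by
        rw [← hψ0]; exact hψ.continuousAt
      filter_upwards [h4 (Metric.ball_mem_nhds _ hρ)] with q hq k
      exact (ContinuousMap.dist_apply_le_dist k).trans_lt hq
    have hsrc : ∀ᶠ p in 𝓝 ((0 : ℝ), x₀), p.2 ∈ c.source :=
      continuousAt_snd (extChartAt_source_mem_nhds x₀)
    filter_upwards [hι.continuousAt.eventually (hnear.and hψs), hsrc] with p ⟨hp1, hp2, hp3⟩ hp4
    refine ⟨fun r => c.symm (ψ (p.1, c p.2) (projIcc (-2) 2 (by norm_num) r)), ?_, ?_, ?_⟩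
    · beta_reduce
      rw [projIcc_of_mem _ (show (0 : ℝ) ∈ Icc (-2) 2 by norm_num), hp2]
      exact c.left_inv hp4
    · beta_reduce
      rw [projIcc_of_mem _ hone]
    · intro r hr
      obtain ⟨h5, h6⟩ := hball (hp1 (projIcc (-2) 2 (by norm_num) r))
      have h7 := hp3 r hr
      rw [h5] at h7
      exact (hasMFDerivAt_extChartAt_symm_comp h6 h7).hasMFDerivWithinAt

variable [CompactSpace V]

/-- By compactness there is an `ε > 0` such that an integral curve on `(-ε, ε)` starts at every
point. -/
theorem exists_uniform_time {X : ∀ x : V, TangentSpace 𝓘(ℝ, E) x}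
    (hX : ContMDiff 𝓘(ℝ, E) 𝓘(ℝ, E).tangent ∞
      (fun x => (⟨x, X x⟩ : TangentBundle 𝓘(ℝ, E) V))) :
    ∃ ε > 0, ∀ x : V, ∃ γ : ℝ → V, γ 0 = x ∧ IsMIntegralCurveOn γ X (Ioo (-ε) ε) := by
  suffices h : ∃ ε > 0, ∀ x ∈ (univ : Set V), ∃ γ : ℝ → V, γ 0 = x ∧
      IsMIntegralCurveOn γ X (Ioo (-ε) ε) by simpa using h
  refine isCompact_univ.induction_on (p := fun S => ∃ ε > 0, ∀ x ∈ S, ∃ γ : ℝ → V, γ 0 = x ∧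
      IsMIntegralCurveOn γ X (Ioo (-ε) ε)) ⟨1, one_pos, by simp⟩
    (fun S T hST ⟨ε, hε, h⟩ => ⟨ε, hε, fun x hx => h x (hST hx)⟩) ?_ ?_
  · rintro S T ⟨ε, hε, h⟩ ⟨δ, hδ, k⟩
    refine ⟨min ε δ, lt_min hε hδ, fun x hx => ?_⟩
    rcases hx with hx | hx
    · obtain ⟨γ, h0, h1⟩ := h x hx
      exact ⟨γ, h0, h1.mono (Ioo_subset_Ioo (neg_le_neg (min_le_left _ _)) (min_le_left _ _))⟩
    · obtain ⟨γ, h0, h1⟩ := k x hx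
      exact ⟨γ, h0, h1.mono (Ioo_subset_Ioo (neg_le_neg (min_le_right _ _)) (min_le_right _ _))⟩
  · intro x₀ _
    obtain ⟨Φ, -, h⟩ := exists_local_flow hX x₀ 0
    rw [nhds_prod_eq] at h
    obtain ⟨P, hP, Q, hQ, hPQ⟩ := eventually_prod_iff.1 h
    obtain ⟨δ, hδ, hδP⟩ := Metric.eventually_nhds_iff.1 hP
    have hs : P (δ / 2) := hδP (by rw [Real.dist_eq, sub_zero, abs_of_pos] <;> linarith)
    refine ⟨{x | Q x}, mem_nhdsWithin_of_mem_nhds hQ, δ, hδ, fun x hx => ?_⟩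
    obtain ⟨γ, h0, -, h1⟩ := hPQ hs hx
    have hne : (δ / 2) ≠ 0 := by positivity
    refine ⟨γ ∘ (· * (δ / 2)⁻¹), by simpa using h0, ?_⟩
    have h2 := h1.comp_mul (δ / 2)⁻¹
    rw [smul_smul, inv_mul_cancel₀ hne, one_smul] at h2
    refine h2.mono fun t ht => ?_
    have hd : 0 < δ / 2 := by positivity
    constructor
    · change -2 < t * (δ / 2)⁻¹
      rw [← div_eq_mul_inv, lt_div_iff₀ hd]; linarith [ht.1]
    · change t * (δ / 2)⁻¹ < 2
      rw [← div_eq_mul_inv, div_lt_iff₀ hd]; linarith [ht.2]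

/-- A smooth vector field on a compact manifold without boundary has a global smooth flow, a
one-parameter group of bijections. -/
theorem exists_flow [T2Space V] {X : ∀ x : V, TangentSpace 𝓘(ℝ, E) x}
    (hX : ContMDiff 𝓘(ℝ, E) 𝓘(ℝ, E).tangent ∞
      (fun x => (⟨x, X x⟩ : TangentBundle 𝓘(ℝ, E) V))) :
    ∃ θ : Multiplicative ℝ →* Equiv.Perm V,
      ContMDiff (𝓘(ℝ, ℝ).prod 𝓘(ℝ, E)) 𝓘(ℝ, E) ∞
        (fun q : ℝ × V => θ (.ofAdd q.1) q.2) ∧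
      ∀ x, IsMIntegralCurve (fun t => θ (.ofAdd t) x) X := by
  have : CompleteSpace E := FiniteDimensional.complete ℝ E
  have hX1 : ContMDiff 𝓘(ℝ, E) 𝓘(ℝ, E).tangent 1
      (fun x => (⟨x, X x⟩ : TangentBundle 𝓘(ℝ, E) V)) := hX.of_le (by exact_mod_cast le_top)
  obtain ⟨ε, hε, hloc⟩ := exists_uniform_time hX
  choose γ hγ0 hγ using exists_isMIntegralCurve_of_isMIntegralCurveOn hX1 hε hloc
  have hadd : ∀ s t x, γ x (s + t) = γ (γ x t) s := by
    intro s t x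
    have h := isMIntegralCurve_Ioo_eq_of_contMDiff_boundaryless (t₀ := 0) hX1
      ((hγ x).comp_add t) (hγ (γ x t)) (by simp [hγ0])
    exact congrFun h s
  have hinv : ∀ t x, γ (γ x t) (-t) = x := fun t x => by rw [← hadd, neg_add_cancel, hγ0]
  let θ : Multiplicative ℝ →* Equiv.Perm V :=
    { toFun := fun t => ⟨fun x => γ x t.toAdd, fun x => γ x (-t.toAdd), hinv _,
        fun x => by simpa using hinv (-t.toAdd) x⟩
      map_one' := by ext x; exact hγ0 x
      map_mul' := fun s t => by ext x; exact hadd _ _ x }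
  refine ⟨θ, contMDiff_infty.2 fun n => ?_, hγ⟩
  -- smoothness for short times
  have hshort : ∃ δ > 0, ∀ x ∈ (univ : Set V), ∀ s, |s| < δ →
      ContMDiffAt (𝓘(ℝ, ℝ).prod 𝓘(ℝ, E)) 𝓘(ℝ, E) n
        (fun q : ℝ × V => θ (.ofAdd q.1) q.2) (s, x) := by
    refine isCompact_univ.induction_on (p := fun S => ∃ δ > 0, ∀ x ∈ S, ∀ s, |s| < δ →
      ContMDiffAt (𝓘(ℝ, ℝ).prod 𝓘(ℝ, E)) 𝓘(ℝ, E) n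
        (fun q : ℝ × V => θ (.ofAdd q.1) q.2) (s, x)) ⟨1, one_pos, by simp⟩
      (fun S T hST ⟨ε, hε, h⟩ => ⟨ε, hε, fun x hx => h x (hST hx)⟩) ?_ ?_
    · rintro S T ⟨ε, hε, h⟩ ⟨δ, hδ, k⟩
      refine ⟨min ε δ, lt_min hε hδ, fun x hx s hs => ?_⟩
      rcases hx with hx | hx
      · exact h x hx s (hs.trans_le (min_le_left _ _))
      · exact k x hx s (hs.trans_le (min_le_right _ _))
    · intro x₀ _
      obtain ⟨Φ, hΦ, h⟩ := exists_local_flow hX x₀ n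
      have h0 : ContMDiffAt (𝓘(ℝ, ℝ).prod 𝓘(ℝ, E)) 𝓘(ℝ, E) n
          (fun q : ℝ × V => θ (.ofAdd q.1) q.2) (0, x₀) := by
        refine hΦ.congr_of_eventuallyEq ?_
        filter_upwards [h] with p ⟨β, hβ0, hβ1, hβ⟩
        have hsX : ContMDiff 𝓘(ℝ, E) 𝓘(ℝ, E).tangent 1
            (fun x => (⟨x, (p.1 • X) x⟩ : TangentBundle 𝓘(ℝ, E) V)) :=
          ContMDiff.const_smul_section hX1
        have h1 := isMIntegralCurveOn_Ioo_eqOn_of_contMDiff_boundaryless (t₀ := 0)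
          (a := -2) (b := 2) (by norm_num) hsX (((hγ p.2).comp_mul p.1).isMIntegralCurveOn _) hβ
          (by simp [hγ0, hβ0])
        have h2 := h1 (x := 1) (by norm_num)
        rw [hβ1] at h2
        simpa [θ] using h2
      have h3 := (contMDiffAt_iff_contMDiffAt_nhds (n := n) (by simp)).1 h0
      rw [nhds_prod_eq] at h3
      obtain ⟨P, hP, Q, hQ, hPQ⟩ := eventually_prod_iff.1 h3
      obtain ⟨δ, hδ, hδP⟩ := Metric.eventually_nhds_iff.1 hP
      exact ⟨{x | Q x}, mem_nhdsWithin_of_mem_nhds hQ, δ, hδ, fun x hx s hs =>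
        hPQ (hδP (by simpa using hs)) hx⟩
  obtain ⟨δ, hδ, hsm⟩ := hshort
  -- smoothness for all times, by the group law
  rintro ⟨t, x⟩
  obtain ⟨N, hN⟩ := exists_nat_gt (|t| / δ)
  have hN0 : (0 : ℝ) < N := (by positivity : (0 : ℝ) ≤ |t| / δ).trans_lt hN
  have htN : |t / N| < δ := by
    rw [abs_div, Nat.abs_cast, div_lt_iff₀ hN0]
    rwa [div_lt_iff₀ hδ, mul_comm] at hN
  have hpow : ∀ k : ℕ, ContMDiffAt (𝓘(ℝ, ℝ).prod 𝓘(ℝ, E)) 𝓘(ℝ, E) n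
      (fun q : ℝ × V => (θ (.ofAdd (q.1 / N)) ^ k) q.2) (t, x) := by
    intro k
    induction k with
    | zero => simpa using! contMDiffAt_snd
    | succ k ih =>
      simp only [pow_succ', Equiv.Perm.mul_apply]
      have h1 : ContMDiffAt (𝓘(ℝ, ℝ).prod 𝓘(ℝ, E)) 𝓘(ℝ, ℝ) n
          (fun q : ℝ × V => q.1 / N) (t, x) := by
        have h2 : ContDiff ℝ n (fun s : ℝ => s / N) := contDiff_id.div_const _
        exact h2.contMDiff.contMDiffAt.comp (t, x) contMDiffAt_fst
      exact (hsm _ (mem_univ _) _ htN).comp (t, x) (h1.prodMk ih)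
  refine (hpow N).congr_of_eventuallyEq (Eventually.of_forall fun q => ?_)
  simp only
  rw [← map_pow, ← ofAdd_nsmul, nsmul_eq_mul, mul_div_cancel₀ _ hN0.ne']

end Flow

/-! ### The exterior derivative of a pulled back form -/

section Pullback

variable {d : ℕ} {V : Type*} [TopologicalSpace V] [ChartedSpace (EuclideanSpace ℝ (Fin d)) V]
  [IsManifold (𝓡 d) ∞ V]

/-- A contact form is smooth as a function on the tangent bundle. -/
theorem ContactForm.contMDiff_apply (α : ContactForm d V) :
    ContMDiff (𝓡 d).tangent 𝓘(ℝ, ℝ) ∞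
      (fun p : TangentBundle (𝓡 d) V => (α.form p.1 p.2 : ℝ)) := by
  have h1 : ContMDiff (𝓡 d).tangent (𝓡 d) ∞
      (Bundle.TotalSpace.proj : TangentBundle (𝓡 d) V → V) :=
    Bundle.contMDiff_proj (TangentSpace (𝓡 d))
  have h := ContMDiff.clm_bundle_apply (F₁ := EuclideanSpace ℝ (Fin d)) (F₂ := ℝ)
    (E₁ := fun x : V => TangentSpace (𝓡 d) x) (E₂ := Bundle.Trivial V ℝ) (IB := 𝓡 d)
    (IM := (𝓡 d).tangent) (n := ∞)
    (b := (Bundle.TotalSpace.proj : TangentBundle (𝓡 d) V → V))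
    (ϕ := fun p => α.form p.1) (v := fun p => p.2) (α.smooth.comp h1) contMDiff_id
  intro p
  have h2 := (Bundle.contMDiffAt_totalSpace (F := ℝ) (E := Bundle.Trivial V ℝ)).1 (h p)
  exact h2.2

/-- The pullback of `α` under a smooth map from a subset of a normed space has smooth
coefficients. -/
theorem ContactForm.contDiffOn_pullback_apply (α : ContactForm d V) {E' : Type*}
    [NormedAddCommGroup E'] [NormedSpace ℝ E'] {F : E' → V} {S : Set E'}
    (hF : ContMDiffOn 𝓘(ℝ, E') (𝓡 d) ∞ F S) (hS : UniqueDiffOn ℝ S) (w : E') :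
    ContDiffOn ℝ ∞ (fun q => (α.form (F q) (mfderivWithin 𝓘(ℝ, E') (𝓡 d) F S q w) : ℝ)) S := by
  rw [← contMDiffOn_iff_contDiffOn]
  have h1 := hF.contMDiffOn_tangentMapWithin (m := ∞) le_rfl hS.uniqueMDiffOn
  have h2 : ContMDiff 𝓘(ℝ, E') 𝓘(ℝ, E').tangent ∞
      (fun q : E' => (⟨q, w⟩ : TangentBundle 𝓘(ℝ, E') E')) := by
    intro q
    rw [Bundle.contMDiffAt_totalSpace]
    refine ⟨contMDiffAt_id, ?_⟩
    simpa using! contMDiffAt_const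
  exact α.contMDiff_apply.comp_contMDiffOn
    (h1.comp h2.contMDiffOn (fun q hq => by simpa using hq))

theorem ContactForm.contDiffOn_coordForm (α : ContactForm d V) (x₀ : V) :
    ContDiffOn ℝ ∞ (coordForm α.form x₀) (extChartAt (𝓡 d) x₀).target := by
  refine contDiffOn_clm_apply.2 fun w => ?_
  have hT := isOpen_extChartAt_target (I := 𝓡 d) x₀
  refine (α.contDiffOn_pullback_apply (contMDiffOn_extChartAt_symm x₀) hT.uniqueDiffOn w).congr
    fun y hy => ?_
  rw [mfderivWithin_of_isOpen hT hy]
  rfl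

theorem coordForm_apply_mfderiv (β : ∀ x : V, TangentSpace (𝓡 d) x →L[ℝ] ℝ) {x₀ x : V}
    (hx : x ∈ (extChartAt (𝓡 d) x₀).source) (v : TangentSpace (𝓡 d) x) :
    coordForm β x₀ (extChartAt (𝓡 d) x₀ x)
      (mfderiv (𝓡 d) 𝓘(ℝ, EuclideanSpace ℝ (Fin d)) (extChartAt (𝓡 d) x₀) x v) = β x v := by
  obtain ⟨y, hy, rfl⟩ : ∃ y ∈ (extChartAt (𝓡 d) x₀).target, (extChartAt (𝓡 d) x₀).symm y = x :=
    ⟨_, (extChartAt (𝓡 d) x₀).map_source hx, (extChartAt (𝓡 d) x₀).left_inv hx⟩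
  have h1 : ∀ u : EuclideanSpace ℝ (Fin d),
      coordForm β x₀ (extChartAt (𝓡 d) x₀ ((extChartAt (𝓡 d) x₀).symm y)) u =
        coordForm β x₀ y u := fun u => by rw [(extChartAt (𝓡 d) x₀).right_inv hy]
  have h2 := mfderiv_extChartAt_symm_apply_mfderiv hx v
  rw [(extChartAt (𝓡 d) x₀).right_inv hy] at h2
  exact (h1 _).trans (congrArg (fun u => β _ u) h2)

/-- The exterior derivative commutes with pullback, `F^* dα = d (F^* α)`, for smooth maps from a
subset `S` of a normed space; the point `p` may lie on the boundary of `S`. -/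
theorem ContactForm.extDerivForm_mfderivWithin (α : ContactForm d V) {E' : Type*}
    [NormedAddCommGroup E'] [NormedSpace ℝ E'] {F : E' → V} {S : Set E'}
    (hF : ContMDiffOn 𝓘(ℝ, E') (𝓡 d) ∞ F S) (hS : UniqueDiffOn ℝ S) {p : E'} (hp : p ∈ S)
    (hp' : p ∈ closure (interior S)) (u w : E') :
    extDerivForm α.form (F p) (mfderivWithin 𝓘(ℝ, E') (𝓡 d) F S p u)
        (mfderivWithin 𝓘(ℝ, E') (𝓡 d) F S p w) =
      fderivWithin ℝ
        (fun q => (α.form (F q) (mfderivWithin 𝓘(ℝ, E') (𝓡 d) F S q w) : ℝ)) S p u -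
      fderivWithin ℝ
        (fun q => (α.form (F q) (mfderivWithin 𝓘(ℝ, E') (𝓡 d) F S q u) : ℝ)) S p w := by
  set c := extChartAt (𝓡 d) (F p) with hc
  set G : E' → EuclideanSpace ℝ (Fin d) := c ∘ F with hG
  have hcs : ∀ x ∈ c.source, ContMDiffAt (𝓡 d) 𝓘(ℝ, EuclideanSpace ℝ (Fin d)) ∞ c x :=
    fun x hx => contMDiffAt_extChartAt' (by rwa [← extChartAt_source (𝓡 d)])
  have hsrc : ∀ᶠ q in 𝓝[S] p, F q ∈ c.source :=
    (hF p hp).continuousWithinAt (extChartAt_source_mem_nhds _)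
  have hdG : ∀ q ∈ S, F q ∈ c.source → fderivWithin ℝ G S q =
      (mfderiv (𝓡 d) 𝓘(ℝ, EuclideanSpace ℝ (Fin d)) c (F q)).comp
        (mfderivWithin 𝓘(ℝ, E') (𝓡 d) F S q) := by
    intro q hq hqs
    rw [← mfderivWithin_eq_fderivWithin]
    exact mfderiv_comp_mfderivWithin q ((hcs _ hqs).mdifferentiableAt (by simp))
      ((hF q hq).mdifferentiableWithinAt (by simp)) (hS q hq).uniqueMDiffWithinAt
  have hGp : ContDiffWithinAt ℝ ∞ G S p := by
    rw [← contMDiffWithinAt_iff_contDiffWithinAt]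
    exact (hcs _ (mem_extChartAt_source _)).comp_contMDiffWithinAt p (hF p hp)
  have hT : IsOpen c.target := isOpen_extChartAt_target _
  have hA : HasFDerivWithinAt (fun q => coordForm α.form (F p) (G q))
      ((fderiv ℝ (coordForm α.form (F p)) (G p)).comp (fderivWithin ℝ G S p)) S p := by
    have h1 : DifferentiableAt ℝ (coordForm α.form (F p)) (G p) :=
      ((α.contDiffOn_coordForm (F p)).contDiffAt
        (hT.mem_nhds (mem_extChartAt_target _))).differentiableAt (by simp)
    exact h1.hasFDerivAt.comp_hasFDerivWithinAt p
      (hGp.differentiableWithinAt (by simp)).hasFDerivWithinAt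
  have hB : HasFDerivWithinAt (fderivWithin ℝ G S) (fderivWithin ℝ (fderivWithin ℝ G S) S p) S p :=
    ((hGp.fderivWithin_right (m := 1) hS (WithTop.coe_le_coe.2 le_top) hp).differentiableWithinAt
      (by simp)).hasFDerivWithinAt
  have key : ∀ u w : E', fderivWithin ℝ
      (fun q => (α.form (F q) (mfderivWithin 𝓘(ℝ, E') (𝓡 d) F S q w) : ℝ)) S p u =
      fderiv ℝ (coordForm α.form (F p)) (G p) (fderivWithin ℝ G S p u) (fderivWithin ℝ G S p w) +
        coordForm α.form (F p) (G p) (fderivWithin ℝ (fderivWithin ℝ G S) S p u w) := by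
    intro u w
    have heq : ∀ q ∈ S, F q ∈ c.source →
        (α.form (F q) (mfderivWithin 𝓘(ℝ, E') (𝓡 d) F S q w) : ℝ) =
          coordForm α.form (F p) (G q) (fderivWithin ℝ G S q w) := by
      intro q hq hqs
      rw [hdG q hq hqs]
      exact (coordForm_apply_mfderiv α.form hqs _).symm
    have hev : (fun q => (α.form (F q) (mfderivWithin 𝓘(ℝ, E') (𝓡 d) F S q w) : ℝ)) =ᶠ[𝓝[S] p]
        fun q => coordForm α.form (F p) (G q) (fderivWithin ℝ G S q w) := by
      filter_upwards [hsrc, self_mem_nhdsWithin] with q hqs hq using heq q hq hqs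
    rw [hev.fderivWithin_eq (heq p hp (mem_extChartAt_source _))]
    have hder := hA.clm_apply (hB.clm_apply (hasFDerivWithinAt_const w p S))
    rw [hder.fderivWithin (hS p hp)]
    simp [add_comm]
  have hsymm : fderivWithin ℝ (fderivWithin ℝ G S) S p u w =
      fderivWithin ℝ (fderivWithin ℝ G S) S p w u :=
    (hGp.isSymmSndFDerivWithinAt (minSmoothness_of_isRCLikeNormedField.trans_le
      (WithTop.coe_le_coe.2 le_top)) hS hp' hp) u w
  rw [key, key, hsymm, hdG p hp (mem_extChartAt_source _), add_sub_add_right_eq_sub]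
  rfl

end Pullback

/-! ### Reeb and contact vector fields -/

section ContactVectors

variable {d : ℕ} {V : Type*} [TopologicalSpace V] [ChartedSpace (EuclideanSpace ℝ (Fin d)) V]
  [IsManifold (𝓡 d) ∞ V]

/-- The bilinear form `dα + α ⊗ α` on `T_x V`; its nondegeneracy is the contact condition. -/
noncomputable def ContactForm.pairing (α : ContactForm d V) (x : V) :
    TangentSpace (𝓡 d) x →ₗ[ℝ] TangentSpace (𝓡 d) x →ₗ[ℝ] ℝ :=
  let D : TangentSpace (𝓡 d) x →L[ℝ] EuclideanSpace ℝ (Fin d) :=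
    mfderiv (𝓡 d) 𝓘(ℝ, EuclideanSpace ℝ (Fin d)) (extChartAt (𝓡 d) x) x
  let L := fderiv ℝ (coordForm α.form x) (extChartAt (𝓡 d) x x)
  LinearMap.mk₂ ℝ (fun v w => L (D v) (D w) - L (D w) (D v) + α.form x v * α.form x w)
    (fun u v w => by simp only [map_add, add_apply]; ring)
    (fun a v w => by simp only [map_smul, smul_apply, smul_eq_mul]; ring)
    (fun u v w => by simp only [map_add, add_apply]; ring)
    (fun a v w => by simp only [map_smul, smul_apply, smul_eq_mul]; ring)

theorem ContactForm.pairing_apply (α : ContactForm d V) (x : V) (v w : TangentSpace (𝓡 d) x) :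
    α.pairing x v w = extDerivForm α.form x v w + α.form x v * α.form x w := rfl

omit [IsManifold (𝓡 d) ∞ V] in
theorem extDerivForm_self (β : ∀ x : V, TangentSpace (𝓡 d) x →L[ℝ] ℝ) (x : V)
    (v : TangentSpace (𝓡 d) x) : extDerivForm β x v v = 0 := sub_self _

omit [IsManifold (𝓡 d) ∞ V] in
theorem extDerivForm_swap (β : ∀ x : V, TangentSpace (𝓡 d) x →L[ℝ] ℝ) (x : V)
    (v w : TangentSpace (𝓡 d) x) : extDerivForm β x v w = -extDerivForm β x w v := by
  simp [extDerivForm]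

theorem ContactForm.extDerivForm_eq (α : ContactForm d V) (x : V) (v w : TangentSpace (𝓡 d) x) :
    extDerivForm α.form x v w = α.pairing x v w - α.form x v * α.form x w := by
  rw [α.pairing_apply, add_sub_cancel_right]

theorem ContactForm.pairing_injective (α : ContactForm d V) (x : V) :
    Function.Injective (α.pairing x) := by
  rw [injective_iff_map_eq_zero]
  intro v hv
  have h0 : ∀ w, extDerivForm α.form x v w + α.form x v * α.form x w = 0 :=
    fun w => DFunLike.congr_fun hv w
  have h1 : α.form x v = 0 := by
    have := h0 v
    rw [extDerivForm_self, zero_add] at this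
    exact mul_self_eq_zero.1 this
  exact α.nondegenerate x v h1 fun w _ => by simpa [h1] using h0 w

instance (x : V) : FiniteDimensional ℝ (TangentSpace (𝓡 d) x) :=
  inferInstanceAs (FiniteDimensional ℝ (EuclideanSpace ℝ (Fin d)))

theorem ContactForm.pairing_surjective (α : ContactForm d V) (x : V) :
    Function.Surjective (α.pairing x) :=
  (LinearMap.injective_iff_surjective_of_finrank_eq_finrank
    (Subspace.dual_finrank_eq (K := ℝ) (V := TangentSpace (𝓡 d) x)).symm).1 (α.pairing_injective x)

/-- The value at `x` of the Reeb field of `α`. -/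
noncomputable def ContactForm.reeb (α : ContactForm d V) (x : V) : TangentSpace (𝓡 d) x :=
  (α.pairing_surjective x (α.form x).toLinearMap).choose

theorem ContactForm.pairing_reeb (α : ContactForm d V) (x : V) (w : TangentSpace (𝓡 d) x) :
    α.pairing x (α.reeb x) w = α.form x w :=
  DFunLike.congr_fun (α.pairing_surjective x (α.form x).toLinearMap).choose_spec w

theorem ContactForm.isReebAt_reeb (α : ContactForm d V) (x : V) : α.IsReebAt x (α.reeb x) := by
  have h := α.pairing_reeb x
  simp only [α.pairing_apply] at h
  have h1 : α.form x (α.reeb x) = 1 := by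
    have h2 := h (α.reeb x)
    rw [extDerivForm_self, zero_add] at h2
    rcases IsIdempotentElem.iff_eq_zero_or_one.1 h2 with h0 | h0
    · exfalso
      refine α.ne_zero x ?_
      have hr : α.reeb x = 0 := α.nondegenerate x _ h0 fun w hw => by simpa [h0, hw] using h w
      ext w
      have h3 := α.pairing_reeb x w
      rw [hr] at h3
      simpa using h3.symm
    · exact h0
  exact ⟨h1, fun w => by simpa [h1] using h w⟩

theorem ContactForm.form_reeb (α : ContactForm d V) (x : V) : α.form x (α.reeb x) = 1 :=
  (α.isReebAt_reeb x).1

theorem ContactForm.extDerivForm_reeb_right (α : ContactForm d V) (x : V)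
    (v : TangentSpace (𝓡 d) x) : extDerivForm α.form x v (α.reeb x) = 0 := by
  rw [extDerivForm_swap, (α.isReebAt_reeb x).2, neg_zero]

/-- The differential of a function, as a real-valued functional on the tangent space. -/
noncomputable def differential (f : V → ℝ) (x : V) : TangentSpace (𝓡 d) x →L[ℝ] ℝ :=
  mfderiv (𝓡 d) 𝓘(ℝ, ℝ) f x

/-- The 1-form `f α - df + df(R) α`, which the pairing turns into the contact vector field
of `f`. -/
noncomputable def ContactForm.hamiltonianForm (α : ContactForm d V) (f : V → ℝ) (x : V) :
    TangentSpace (𝓡 d) x →L[ℝ] ℝ :=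
  (f x + differential f x (α.reeb x)) • α.form x - differential f x

/-- The value at `x` of the contact vector field of the function `f`. -/
noncomputable def ContactForm.contactField (α : ContactForm d V) (f : V → ℝ) (x : V) :
    TangentSpace (𝓡 d) x :=
  (α.pairing_surjective x (α.hamiltonianForm f x).toLinearMap).choose

theorem ContactForm.pairing_contactField (α : ContactForm d V) (f : V → ℝ) (x : V)
    (w : TangentSpace (𝓡 d) x) :
    α.pairing x (α.contactField f x) w = α.hamiltonianForm f x w :=
  DFunLike.congr_fun (α.pairing_surjective x (α.hamiltonianForm f x).toLinearMap).choose_spec w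

theorem ContactForm.hamiltonianForm_apply (α : ContactForm d V) (f : V → ℝ) (x : V)
    (w : TangentSpace (𝓡 d) x) : α.hamiltonianForm f x w =
      (f x + differential f x (α.reeb x)) * α.form x w - differential f x w := rfl

theorem ContactForm.isContactVectorAt_contactField (α : ContactForm d V) (f : V → ℝ) (x : V) :
    α.IsContactVectorAt f x (α.contactField f x) := by
  have h := α.pairing_contactField f x
  simp only [α.pairing_apply, α.hamiltonianForm_apply] at h
  have h1 : α.form x (α.contactField f x) = f x := by
    have h2 := h (α.reeb x)
    rw [α.extDerivForm_reeb_right, α.form_reeb] at h2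
    linarith
  refine ⟨α.reeb x, α.isReebAt_reeb x, h1, fun w => ?_⟩
  have h3 := h w
  rw [h1] at h3
  change _ = -differential f x w + differential f x (α.reeb x) * α.form x w
  linarith

/-- A vector `v` with `α(v) = f` which satisfies the equation of the contact vector field on
`ξ` is the contact vector of `f`: the equation holds on the Reeb direction in any case. -/
theorem ContactForm.isContactVectorAt_of_ker (α : ContactForm d V) {f : V → ℝ} {x : V}
    {v : TangentSpace (𝓡 d) x} (hv : α.form x v = f x)
    (h : ∀ w, α.form x w = 0 → extDerivForm α.form x v w = -differential f x w) :
    α.IsContactVectorAt f x v := by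
  refine ⟨α.reeb x, α.isReebAt_reeb x, hv, fun w => ?_⟩
  have h1 := h (w - α.form x w • α.reeb x) (by
    rw [map_sub, map_smul, α.form_reeb, smul_eq_mul, mul_one, sub_self])
  have h2 : extDerivForm α.form x v (w - α.form x w • α.reeb x) = extDerivForm α.form x v w := by
    have h3 : α.pairing x v (α.reeb x) = α.form x v := by
      rw [α.pairing_apply, α.extDerivForm_reeb_right, α.form_reeb, zero_add, mul_one]
    simp only [α.extDerivForm_eq, map_sub, map_smul, h3, smul_eq_mul, α.form_reeb]
    ring
  rw [h2, map_sub, map_smul, smul_eq_mul] at h1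
  change _ = -differential f x w + differential f x (α.reeb x) * α.form x w
  linarith

/-- A vector field determined by an equation `dα(X, ·) + α(X) α = β`, with a form `β` which has
smooth coordinate expressions, is smooth: in a chart the equation is linear, with an invertible
operator which depends smoothly on the point. -/
theorem ContactForm.contMDiff_of_pairing_eq (α : ContactForm d V)
    {X : ∀ x : V, TangentSpace (𝓡 d) x} {β : ∀ x : V, TangentSpace (𝓡 d) x →L[ℝ] ℝ}
    (hβ : ∀ x₀ : V, ContDiffOn ℝ ∞ (coordForm β x₀) (extChartAt (𝓡 d) x₀).target)
    (hX : ∀ x w, α.pairing x (X x) w = β x w) :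
    ContMDiff (𝓡 d) (𝓡 d).tangent ∞ (fun x => (⟨x, X x⟩ : TangentBundle (𝓡 d) V)) := by
  intro x₀
  set c := extChartAt (𝓡 d) x₀ with hc
  have hT : IsOpen c.target := isOpen_extChartAt_target x₀
  refine (contMDiffAt_vectorField_iff (n := ⊤) (mem_extChartAt_source x₀)).2 ?_
  -- the operator `v ↦ dα(v, ·) + α(v) α` in the chart
  let a := coordForm α.form x₀
  let A : EuclideanSpace ℝ (Fin d) → EuclideanSpace ℝ (Fin d) →L[ℝ]
      EuclideanSpace ℝ (Fin d) →L[ℝ] ℝ :=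
    fun y => fderiv ℝ a y - (fderiv ℝ a y).flip + (a y).smulRight (a y)
  have ha : ContDiffOn ℝ ∞ a c.target := α.contDiffOn_coordForm x₀
  have hA : ContDiffOn ℝ ∞ A c.target := by
    have h1 : ContDiffOn ℝ ∞ (fderiv ℝ a) c.target := ha.fderiv_of_isOpen hT le_rfl
    have h2 : ContDiffOn ℝ ∞ (fun y => (fderiv ℝ a y).flip) c.target :=
      contDiffOn_clm_apply.2 fun v => contDiffOn_clm_apply.2 fun w =>
        (h1.clm_apply contDiffOn_const).clm_apply contDiffOn_const
    exact (h1.sub h2).add (ha.smulRight ha)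
  have hAp : ∀ y ∈ c.target, ∀ u w : EuclideanSpace ℝ (Fin d), A y u w =
      α.pairing (c.symm y) (mfderiv 𝓘(ℝ, EuclideanSpace ℝ (Fin d)) (𝓡 d) c.symm y u)
        (mfderiv 𝓘(ℝ, EuclideanSpace ℝ (Fin d)) (𝓡 d) c.symm y w) := by
    intro y hy u w
    have hnat := α.extDerivForm_mfderivWithin (contMDiffOn_extChartAt_symm x₀) hT.uniqueDiffOn hy
      (by rw [hT.interior_eq]; exact subset_closure hy) u w
    have hcoef : ∀ w : EuclideanSpace ℝ (Fin d), (fun q => (α.form (c.symm q)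
        (mfderivWithin 𝓘(ℝ, EuclideanSpace ℝ (Fin d)) (𝓡 d) c.symm c.target q w) : ℝ))
        =ᶠ[𝓝 y] fun q => a q w := by
      intro w
      filter_upwards [hT.mem_nhds hy] with q hq
      rw [mfderivWithin_of_isOpen hT hq]
      rfl
    have hda : DifferentiableAt ℝ a y :=
      (ha.contDiffAt (hT.mem_nhds hy)).differentiableAt (by simp)
    have hfd : ∀ u w : EuclideanSpace ℝ (Fin d), fderiv ℝ (fun q => a q w) y u =
        fderiv ℝ a y u w := by
      intro u w
      rw [(hda.hasFDerivAt.clm_apply (hasFDerivAt_const w y)).fderiv]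
      simp
    rw [fderivWithin_of_isOpen hT hy, fderivWithin_of_isOpen hT hy, (hcoef w).fderiv_eq,
      (hcoef u).fderiv_eq, mfderivWithin_of_isOpen hT hy, hfd, hfd] at hnat
    rw [α.pairing_apply, hnat]
    rfl
  have hinj : ∀ y ∈ c.target, Function.Injective (A y) := by
    intro y hy
    rw [injective_iff_map_eq_zero]
    intro u hu
    have hx := c.map_target hy
    have h1 : mfderiv 𝓘(ℝ, EuclideanSpace ℝ (Fin d)) (𝓡 d) c.symm y u = 0 := by
      refine α.pairing_injective (c.symm y) ?_
      rw [map_zero]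
      ext v
      have h2 := mfderiv_extChartAt_symm_apply_mfderiv hx v
      rw [c.right_inv hy] at h2
      rw [← h2]
      have h3 := hAp y hy u (mfderiv (𝓡 d) 𝓘(ℝ, EuclideanSpace ℝ (Fin d)) c (c.symm y) v)
      rw [hu] at h3
      exact h3.symm
    have h4 := mfderiv_extChartAt_apply_mfderiv_symm hy u
    rw [← hc, h1, map_zero] at h4
    exact h4.symm
  have hinv : ∀ y ∈ c.target, (A y).IsInvertible := by
    intro y hy
    have hfr : Module.finrank ℝ (EuclideanSpace ℝ (Fin d)) =
        Module.finrank ℝ (EuclideanSpace ℝ (Fin d) →L[ℝ] ℝ) := by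
      rw [← LinearMap.toContinuousLinearMap.finrank_eq (R := ℝ)]
      exact (Subspace.dual_finrank_eq (K := ℝ)).symm
    exact ⟨(LinearEquiv.ofInjectiveOfFinrankEq (A y).toLinearMap (hinj y hy)
      hfr).toContinuousLinearEquiv, by ext; rfl⟩
  -- the field is obtained by inverting the operator
  have hsol : ∀ y ∈ c.target,
      coordField X x₀ y = (A y).inverse (coordForm β x₀ y) := by
    intro y hy
    rw [eq_comm, (hinv _ hy).inverse_apply_eq]
    ext w
    have hx := c.map_target hy
    have h2 := mfderiv_extChartAt_symm_apply_mfderiv hx (X (c.symm y))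
    rw [c.right_inv hy] at h2
    refine Eq.trans ?_ ((hAp y hy _ w).trans (congrArg (fun v => α.pairing _ v _) h2)).symm
    rw [hX]
    rfl
  have hsm : ContDiffAt ℝ ∞ (fun y => (A y).inverse (coordForm β x₀ y)) (c x₀) := by
    have hy := mem_extChartAt_target (I := 𝓡 d) x₀
    obtain ⟨e, he⟩ := hinv _ hy
    have h1 : ContDiffAt ℝ ∞ (fun y => (A y).inverse) (c x₀) := by
      have h2 := contDiffAt_map_inverse (n := ∞) e
      rw [he] at h2
      exact h2.comp _ (hA.contDiffAt (hT.mem_nhds hy))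
    exact h1.clm_apply ((hβ x₀).contDiffAt (hT.mem_nhds hy))
  refine (hsm.contMDiffAt.comp x₀ (contMDiffAt_extChartAt)).congr_of_eventuallyEq ?_
  filter_upwards [extChartAt_source_mem_nhds (I := 𝓡 d) x₀] with x hx
  obtain ⟨y, hy, rfl⟩ : ∃ y ∈ c.target, c.symm y = x := ⟨_, c.map_source hx, c.left_inv hx⟩
  exact (hsol y hy).trans
    (congrArg (fun y => (A y).inverse (coordForm β x₀ y)) (c.right_inv hy).symm)

end ContactVectors

section SmoothFields

variable {d : ℕ} {V : Type*} [TopologicalSpace V] [ChartedSpace (EuclideanSpace ℝ (Fin d)) V]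
  [IsManifold (𝓡 d) ∞ V]

theorem ContactForm.contMDiff_reeb (α : ContactForm d V) :
    ContMDiff (𝓡 d) (𝓡 d).tangent ∞ (fun x => (⟨x, α.reeb x⟩ : TangentBundle (𝓡 d) V)) :=
  α.contMDiff_of_pairing_eq α.contDiffOn_coordForm α.pairing_reeb

theorem contMDiff_differential_apply {f : V → ℝ} (hf : ContMDiff (𝓡 d) 𝓘(ℝ, ℝ) ∞ f)
    {Y : ∀ x : V, TangentSpace (𝓡 d) x}
    (hY : ContMDiff (𝓡 d) (𝓡 d).tangent ∞ (fun x => (⟨x, Y x⟩ : TangentBundle (𝓡 d) V))) :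
    ContMDiff (𝓡 d) 𝓘(ℝ, ℝ) ∞ (fun x => differential f x (Y x)) := by
  have h1 := (hf.contMDiff_tangentMap (m := ∞) le_rfl).comp hY
  intro x
  have h2 := ((Bundle.contMDiffAt_totalSpace (F := ℝ) (E := TangentSpace 𝓘(ℝ, ℝ))).1 (h1 x)).2
  simpa using! h2

theorem ContactForm.contMDiff_contactField (α : ContactForm d V) {f : V → ℝ}
    (hf : ContMDiff (𝓡 d) 𝓘(ℝ, ℝ) ∞ f) :
    ContMDiff (𝓡 d) (𝓡 d).tangent ∞
      (fun x => (⟨x, α.contactField f x⟩ : TangentBundle (𝓡 d) V)) := by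
  refine α.contMDiff_of_pairing_eq (fun x₀ => ?_) (α.pairing_contactField f)
  set c := extChartAt (𝓡 d) x₀
  have hT : IsOpen c.target := isOpen_extChartAt_target x₀
  have hc : ContMDiffOn 𝓘(ℝ, EuclideanSpace ℝ (Fin d)) (𝓡 d) ∞ c.symm c.target :=
    contMDiffOn_extChartAt_symm x₀
  have hfc : ContDiffOn ℝ ∞ (f ∘ c.symm) c.target :=
    contMDiffOn_iff_contDiffOn.1 (hf.comp_contMDiffOn hc)
  have hg : ContDiffOn ℝ ∞ (fun y => f (c.symm y) + differential f (c.symm y)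
      (α.reeb (c.symm y))) c.target :=
    hfc.add (contMDiffOn_iff_contDiffOn.1
      ((contMDiff_differential_apply hf α.contMDiff_reeb).comp_contMDiffOn hc))
  refine ((hg.smul (α.contDiffOn_coordForm x₀)).sub
    (hfc.fderiv_of_isOpen hT le_rfl)).congr fun y hy => ?_
  have hd : fderiv ℝ (f ∘ c.symm) y = (mfderiv (𝓡 d) 𝓘(ℝ, ℝ) f (c.symm y)).comp
      (mfderiv 𝓘(ℝ, EuclideanSpace ℝ (Fin d)) (𝓡 d) c.symm y) := by
    rw [← mfderiv_eq_fderiv]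
    exact mfderiv_comp y (hf.mdifferentiableAt (by simp))
      ((hc.contMDiffAt (hT.mem_nhds hy)).mdifferentiableAt (by simp))
  rw [hd]
  rfl

end SmoothFields

/-! ### Cartan's formula along an isotopy -/

section Cartan

variable {d : ℕ} {V : Type*} [TopologicalSpace V] [ChartedSpace (EuclideanSpace ℝ (Fin d)) V]
  [IsManifold (𝓡 d) ∞ V]

/-- The velocity at time `t` of a family of maps `φ`, a tangent vector at `φ t x`. -/
noncomputable def velocity (φ : unitInterval → V → V) (t : unitInterval) (x : V) :
    TangentSpace (𝓡 d) (φ t x) :=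
  mfderiv (𝓡∂ 1) (𝓡 d) (fun s => φ s x) t (1 : TangentSpace (𝓡∂ 1) t)

theorem contMDiff_one_unitInterval :
    ContMDiff (𝓡∂ 1) (𝓡∂ 1).tangent ∞
      (fun t : unitInterval => (⟨t, 1⟩ : TangentBundle (𝓡∂ 1) unitInterval)) := by
  have h1 : ContMDiffOn 𝓘(ℝ, ℝ).tangent (𝓡∂ 1).tangent ∞ _ _ :=
    (contMDiffOn_projIcc (x := 0) (y := 1) (n := ∞)).contMDiffOn_tangentMapWithin (m := ∞) le_rfl
      (uniqueDiffOn_Icc one_pos).uniqueMDiffOn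
  have h2 : ContMDiff 𝓘(ℝ, ℝ) 𝓘(ℝ, ℝ).tangent ∞
      (fun q : ℝ => (⟨q, (1 : ℝ)⟩ : TangentBundle 𝓘(ℝ, ℝ) ℝ)) := by
    intro q
    rw [Bundle.contMDiffAt_totalSpace]
    refine ⟨contMDiffAt_id, ?_⟩
    simpa using! contMDiffAt_const
  have h3 := h1.comp_contMDiff (h2.comp (contMDiff_subtypeVal_Icc (x := 0) (y := 1) (n := ∞)))
    fun t => t.2
  convert! h3 using 2 with t
  have h4 : ∀ z z' : unitInterval, z = z' → ∀ v : EuclideanSpace ℝ (Fin 1),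
      (⟨z, v⟩ : TangentBundle (𝓡∂ 1) unitInterval) = ⟨z', v⟩ := by
    rintro z _ rfl v; rfl
  have h5 : (1 : TangentSpace (𝓡∂ 1) t) = oneTangentSpaceIcc t := rfl
  rw [h5, oneTangentSpaceIcc]
  exact h4 _ _ (projIcc_val _ t).symm _

variable {φ : unitInterval → V → V}

omit [IsManifold (𝓡 d) ∞ V] in
theorem mfderiv_uncurry_apply
    (hφ : ContMDiff ((𝓡∂ 1).prod (𝓡 d)) (𝓡 d) ∞ (fun q : unitInterval × V => φ q.1 q.2))
    (t : unitInterval) (x : V) (a : TangentSpace (𝓡∂ 1) t) (v : TangentSpace (𝓡 d) x) :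
    mfderiv ((𝓡∂ 1).prod (𝓡 d)) (𝓡 d) (fun q : unitInterval × V => φ q.1 q.2) (t, x) (a, v) =
      mfderiv (𝓡∂ 1) (𝓡 d) (fun s => φ s x) t a + mfderiv (𝓡 d) (𝓡 d) (φ t) x v :=
  mfderiv_prod_eq_add_apply (hφ.mdifferentiableAt (by simp))

/-- For a smooth isotopy `φ`, the function `α(dφ/dt)` of `(t, x)` is smooth. -/
theorem ContactForm.contMDiff_form_velocity (α : ContactForm d V)
    (hφ : ContMDiff ((𝓡∂ 1).prod (𝓡 d)) (𝓡 d) ∞ (fun q : unitInterval × V => φ q.1 q.2)) :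
    ContMDiff ((𝓡∂ 1).prod (𝓡 d)) 𝓘(ℝ, ℝ) ∞
      (fun q : unitInterval × V => (α.form (φ q.1 q.2) (velocity φ q.1 q.2) : ℝ)) := by
  have h1 := (contMDiff_one_unitInterval.comp (contMDiff_fst (M := unitInterval) (N := V)
    (I := 𝓡∂ 1) (J := 𝓡 d))).prodMk ((Bundle.contMDiff_zeroSection ℝ
      (fun x : V => TangentSpace (𝓡 d) x) (IB := 𝓡 d) (n := ∞)
      (F := EuclideanSpace ℝ (Fin d))).comp
        (contMDiff_snd (M := unitInterval) (N := V) (I := 𝓡∂ 1) (J := 𝓡 d)))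
  have h2 := α.contMDiff_apply.comp ((hφ.contMDiff_tangentMap (m := ∞) le_rfl).comp
    (contMDiff_equivTangentBundleProd_symm.comp h1))
  refine h2.congr fun q => ?_
  have h3 := mfderiv_uncurry_apply hφ q.1 q.2 1 0
  rw [map_zero, add_zero] at h3
  exact congrArg (α.form (φ q.1 q.2)) h3.symm

/-- For a smooth family `φ` and a smooth vector field `Y`, the function `α(dφ_t(Y))` of `(t, x)`
is smooth. -/
theorem ContactForm.contMDiff_form_mfderiv (α : ContactForm d V)
    (hφ : ContMDiff ((𝓡∂ 1).prod (𝓡 d)) (𝓡 d) ∞ (fun q : unitInterval × V => φ q.1 q.2))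
    {Y : ∀ x : V, TangentSpace (𝓡 d) x}
    (hY : ContMDiff (𝓡 d) (𝓡 d).tangent ∞ (fun x => (⟨x, Y x⟩ : TangentBundle (𝓡 d) V))) :
    ContMDiff ((𝓡∂ 1).prod (𝓡 d)) 𝓘(ℝ, ℝ) ∞ (fun q : unitInterval × V =>
      (α.form (φ q.1 q.2) (mfderiv (𝓡 d) (𝓡 d) (φ q.1) q.2 (Y q.2)) : ℝ)) := by
  have h1 := ((Bundle.contMDiff_zeroSection ℝ
      (fun t : unitInterval => TangentSpace (𝓡∂ 1) t) (IB := 𝓡∂ 1) (n := ∞)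
      (F := EuclideanSpace ℝ (Fin 1))).comp (contMDiff_fst (M := unitInterval) (N := V)
    (I := 𝓡∂ 1) (J := 𝓡 d))).prodMk (hY.comp
        (contMDiff_snd (M := unitInterval) (N := V) (I := 𝓡∂ 1) (J := 𝓡 d)))
  have h2 := α.contMDiff_apply.comp ((hφ.contMDiff_tangentMap (m := ∞) le_rfl).comp
    (contMDiff_equivTangentBundleProd_symm.comp h1))
  refine h2.congr fun q => ?_
  have h3 := mfderiv_uncurry_apply hφ q.1 q.2 0 (Y q.2)
  rw [map_zero, zero_add] at h3
  exact congrArg (α.form (φ q.1 q.2)) h3.symm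

end Cartan

section Cartan

variable {d : ℕ} {V : Type*} [TopologicalSpace V] [ChartedSpace (EuclideanSpace ℝ (Fin d)) V]
  [IsManifold (𝓡 d) ∞ V] {φ : unitInterval → V → V}

/-- Equality of values of `α` at equal points: tangent vectors at different points are compared as
elements of the common model space, which avoids a cast between tangent spaces. -/
theorem ContactForm.form_congr (α : ContactForm d V) {z z' : V} (h : z = z')
    {v v' : EuclideanSpace ℝ (Fin d)} (hv : v = v') :
    (α.form z : EuclideanSpace ℝ (Fin d) → ℝ) v =
      (α.form z' : EuclideanSpace ℝ (Fin d) → ℝ) v' := by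
  subst h hv; rfl

/-- Cartan's formula in a chart, for the tangent vector with coordinates `w`. It is the identity
`F^* dα = d (F^* α)` for `F (s, y) = φ_s(c⁻¹ y)` on `[0, 1] × ℝᵈ`, evaluated on `∂/∂s` and `w`. -/
theorem ContactForm.hasDerivWithinAt_form_mfderiv_chart (α : ContactForm d V)
    (hφ : ContMDiff ((𝓡∂ 1).prod (𝓡 d)) (𝓡 d) ∞ (fun q : unitInterval × V => φ q.1 q.2))
    (t : unitInterval) (x₀ : V) {y : EuclideanSpace ℝ (Fin d)}
    (hy : y ∈ (extChartAt (𝓡 d) x₀).target) (w : EuclideanSpace ℝ (Fin d))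
    {x : V} (hx : x = (extChartAt (𝓡 d) x₀).symm y)
    {v : TangentSpace (𝓡 d) x} (hv : (v : EuclideanSpace ℝ (Fin d)) =
      mfderiv 𝓘(ℝ, EuclideanSpace ℝ (Fin d)) (𝓡 d) (extChartAt (𝓡 d) x₀).symm y w) :
    HasDerivWithinAt
      (fun s : ℝ => (α.form (φ (projIcc 0 1 zero_le_one s) x)
        (mfderiv (𝓡 d) (𝓡 d) (φ (projIcc 0 1 zero_le_one s)) x v) : ℝ))
      (extDerivForm α.form (φ t x) (velocity φ t x) (mfderiv (𝓡 d) (𝓡 d) (φ t) x v) +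
        differential (fun z => (α.form (φ t z) (velocity φ t z) : ℝ)) x v) (Icc 0 1) t := by
  subst hx
  subst hv
  set c := extChartAt (𝓡 d) x₀ with hc
  have hT : IsOpen c.target := isOpen_extChartAt_target x₀
  have hcs : ContMDiffOn 𝓘(ℝ, EuclideanSpace ℝ (Fin d)) (𝓡 d) ∞ c.symm c.target :=
    contMDiffOn_extChartAt_symm x₀
  set F : ℝ × EuclideanSpace ℝ (Fin d) → V :=
    fun q => φ (projIcc 0 1 zero_le_one q.1) (c.symm q.2) with hFdef
  set S : Set (ℝ × EuclideanSpace ℝ (Fin d)) := Icc 0 1 ×ˢ c.target with hSdef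
  have hF : ContMDiffOn 𝓘(ℝ, ℝ × EuclideanSpace ℝ (Fin d)) (𝓡 d) ∞ F S := by
    refine hφ.comp_contMDiffOn (ContMDiffOn.prodMk ?_ ?_)
    · exact (contMDiffOn_projIcc (x := 0) (y := 1)).comp contDiff_fst.contMDiff.contMDiffOn
        fun q hq => hq.1
    · exact hcs.comp contDiff_snd.contMDiff.contMDiffOn fun q hq => hq.2
  have hS : UniqueDiffOn ℝ S := (uniqueDiffOn_Icc one_pos).prod hT.uniqueDiffOn
  have hS' : ∀ (t : unitInterval), ∀ y ∈ c.target, ((t : ℝ), y) ∈ S := fun t y hy => ⟨t.2, hy⟩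
  have hcl : ((t : ℝ), y) ∈ closure (interior S) := by
    rw [interior_prod_eq, closure_prod_eq, interior_Icc, closure_Ioo zero_ne_one, hT.interior_eq]
    exact ⟨t.2, subset_closure hy⟩
  have hFd : ∀ q ∈ S, HasMFDerivWithinAt 𝓘(ℝ, ℝ × EuclideanSpace ℝ (Fin d)) (𝓡 d) F S q
      (mfderivWithin 𝓘(ℝ, ℝ × EuclideanSpace ℝ (Fin d)) (𝓡 d) F S q) := fun q hq =>
    ((hF q hq).mdifferentiableWithinAt (by simp)).hasMFDerivWithinAt
  have hbase : ∀ (t : unitInterval) (y : EuclideanSpace ℝ (Fin d)),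
      F ((t : ℝ), y) = φ t (c.symm y) := fun t y => by simp only [hFdef, projIcc_val]
  -- the partial derivatives of `F`
  have hinl : ∀ (t : unitInterval), ∀ y ∈ c.target, (mfderivWithin
      𝓘(ℝ, ℝ × EuclideanSpace ℝ (Fin d)) (𝓡 d) F S ((t : ℝ), y) ((1 : ℝ), 0) :
        EuclideanSpace ℝ (Fin d)) = velocity φ t (c.symm y) := by
    intro t y hy
    have h1 : HasMFDerivWithinAt 𝓘(ℝ, ℝ) 𝓘(ℝ, ℝ × EuclideanSpace ℝ (Fin d))
        (fun r : ℝ => (r, y)) (Icc 0 1) (t : ℝ) (.inl ℝ ℝ (EuclideanSpace ℝ (Fin d))) :=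
      (hasFDerivAt_prodMk_left (t : ℝ) y).hasFDerivWithinAt.hasMFDerivWithinAt
    have h2 := (hFd _ (hS' t y hy)).comp (t : ℝ) h1
      (show MapsTo (fun r : ℝ => (r, y)) (Icc 0 1) S from fun r hr => ⟨hr, hy⟩)
    have h3 := h2.mfderivWithin (uniqueDiffOn_Icc one_pos _ t.2).uniqueMDiffWithinAt
    have h4 := mfderivWithin_comp_projIcc_one (I := 𝓡 d) (x := 0) (y := 1)
      (f := fun s => φ s (c.symm y)) (w := t)
    exact (congrArg (fun A => A (1 : ℝ)) h3).symm.trans h4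
  have hinr : ∀ (t : unitInterval), ∀ y ∈ c.target, ∀ w, (mfderivWithin
      𝓘(ℝ, ℝ × EuclideanSpace ℝ (Fin d)) (𝓡 d) F S ((t : ℝ), y) ((0 : ℝ), w) :
        EuclideanSpace ℝ (Fin d)) = mfderiv (𝓡 d) (𝓡 d) (φ t) (c.symm y)
          (mfderiv 𝓘(ℝ, EuclideanSpace ℝ (Fin d)) (𝓡 d) c.symm y w) := by
    intro t y hy w
    have h1 : HasMFDerivWithinAt 𝓘(ℝ, EuclideanSpace ℝ (Fin d))
        𝓘(ℝ, ℝ × EuclideanSpace ℝ (Fin d))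
        (fun z : EuclideanSpace ℝ (Fin d) => ((t : ℝ), z)) c.target y
        (.inr ℝ ℝ (EuclideanSpace ℝ (Fin d))) :=
      (hasFDerivAt_prodMk_right (t : ℝ) y).hasFDerivWithinAt.hasMFDerivWithinAt
    have h2 := (hFd _ (hS' t y hy)).comp y h1
      (show MapsTo (fun z => ((t : ℝ), z)) c.target S from fun z hz => ⟨t.2, hz⟩)
    have h3 := (h2.hasMFDerivAt (hT.mem_nhds hy)).mfderiv
    have h4 : F ∘ (fun z : EuclideanSpace ℝ (Fin d) => ((t : ℝ), z)) = φ t ∘ c.symm := by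
      funext z; exact hbase t z
    have hφt : ContMDiff (𝓡 d) (𝓡 d) ∞ (φ t) := hφ.comp (contMDiff_const.prodMk contMDiff_id)
    have h5 := mfderiv_comp (I := 𝓘(ℝ, EuclideanSpace ℝ (Fin d))) (I' := 𝓡 d) (I'' := 𝓡 d)
      (g := φ t) y (hφt.mdifferentiableAt (by simp))
      ((hcs.contMDiffAt (hT.mem_nhds hy)).mdifferentiableAt (by simp))
    rw [h4] at h3
    exact (congrArg (fun A => A w) h3).symm.trans (congrArg (fun A => A w) h5)
  -- the coefficients of `F^* α`
  have hcoef := α.contDiffOn_pullback_apply hF hS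
  have hp := hS' t y hy
  have hd : ∀ w, HasFDerivWithinAt (fun q => (α.form (F q) (mfderivWithin
      𝓘(ℝ, ℝ × EuclideanSpace ℝ (Fin d)) (𝓡 d) F S q w) : ℝ)) (fderivWithin ℝ (fun q =>
        (α.form (F q) (mfderivWithin 𝓘(ℝ, ℝ × EuclideanSpace ℝ (Fin d)) (𝓡 d) F S q w) : ℝ)) S
          ((t : ℝ), y)) S ((t : ℝ), y) := fun w =>
    ((hcoef w).differentiableOn (by simp) _ hp).hasFDerivWithinAt
  have hnat := α.extDerivForm_mfderivWithin hF hS hp hcl ((1 : ℝ), 0) ((0 : ℝ), w)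
  have hder1 := (hd ((0 : ℝ), w)).comp_hasDerivWithinAt (t : ℝ)
    ((hasFDerivAt_prodMk_left (𝕜 := ℝ) (t : ℝ) y).hasFDerivWithinAt.hasDerivWithinAt (s := Icc 0 1))
    (show MapsTo (fun r : ℝ => (r, y)) (Icc 0 1) S from fun r hr => ⟨hr, hy⟩)
  have hder2 := ((hd ((1 : ℝ), 0)).comp y
    (hasFDerivAt_prodMk_right (𝕜 := ℝ) (t : ℝ) y).hasFDerivWithinAt
    (fun z hz => ⟨t.2, hz⟩ : MapsTo _ c.target S)).hasFDerivAt (hT.mem_nhds hy)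
  have hK : ContMDiff (𝓡 d) 𝓘(ℝ, ℝ) ∞
      (fun z => (α.form (φ t z) (velocity φ t z) : ℝ)) :=
    (α.contMDiff_form_velocity hφ).comp (contMDiff_const.prodMk contMDiff_id)
  have hder3 := (hK.mdifferentiableAt (x := c.symm y) (by simp)).hasMFDerivAt.comp y
    ((hcs.contMDiffAt (hT.mem_nhds hy)).mdifferentiableAt (by simp)).hasMFDerivAt
  have hder4 := hder2.congr_of_eventuallyEq
    (f₁ := (fun z => (α.form (φ t z) (velocity φ t z) : ℝ)) ∘ c.symm) (by
    filter_upwards [hT.mem_nhds hy] with z hz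
    exact (α.form_congr (hbase t z) (hinl t z hz)).symm)
  have heq := congrArg (fun A : EuclideanSpace ℝ (Fin d) →L[ℝ] ℝ => A w)
    (hder4.unique hder3.hasFDerivAt)
  have hext : extDerivForm α.form (φ t (c.symm y)) (velocity φ t (c.symm y))
      (mfderiv (𝓡 d) (𝓡 d) (φ t) (c.symm y)
        (mfderiv 𝓘(ℝ, EuclideanSpace ℝ (Fin d)) (𝓡 d) c.symm y w)) =
      extDerivForm α.form (F ((t : ℝ), y))
        (mfderivWithin 𝓘(ℝ, ℝ × EuclideanSpace ℝ (Fin d)) (𝓡 d) F S ((t : ℝ), y) ((1 : ℝ), 0))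
        (mfderivWithin 𝓘(ℝ, ℝ × EuclideanSpace ℝ (Fin d)) (𝓡 d) F S ((t : ℝ), y) ((0 : ℝ), w)) := by
    have hgen : ∀ z z' : V, z = z' → ∀ u u' w w' : EuclideanSpace ℝ (Fin d), u = u' → w = w' →
        extDerivForm α.form z u w = extDerivForm α.form z' u' w' := by
      rintro z _ rfl u _ w _ rfl rfl; rfl
    exact hgen _ _ (hbase t y).symm _ _ _ _ (hinl t y hy).symm (hinr t y hy w).symm
  have hval : extDerivForm α.form (φ t (c.symm y)) (velocity φ t (c.symm y))
      (mfderiv (𝓡 d) (𝓡 d) (φ t) (c.symm y)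
        (mfderiv 𝓘(ℝ, EuclideanSpace ℝ (Fin d)) (𝓡 d) c.symm y w)) +
      differential (fun z => (α.form (φ t z) (velocity φ t z) : ℝ)) (c.symm y)
        (mfderiv 𝓘(ℝ, EuclideanSpace ℝ (Fin d)) (𝓡 d) c.symm y w) =
      fderivWithin ℝ (fun q => (α.form (F q) (mfderivWithin
        𝓘(ℝ, ℝ × EuclideanSpace ℝ (Fin d)) (𝓡 d) F S q ((0 : ℝ), w)) : ℝ)) S ((t : ℝ), y)
          ((1 : ℝ), 0) := by
    rw [hext, hnat, sub_add_eq_add_sub, sub_eq_iff_eq_add]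
    exact congrArg (_ + ·) heq.symm
  rw [hval]
  refine hder1.congr (fun s hs => ?_) ?_
  · refine Eq.trans ?_ (α.form_congr (hbase ⟨s, hs⟩ y) (hinr ⟨s, hs⟩ y hy w)).symm
    rw [projIcc_of_mem zero_le_one hs]
  · refine Eq.trans ?_ (α.form_congr (hbase t y) (hinr t y hy w)).symm
    rw [projIcc_val]

/-- Cartan's formula along a smooth isotopy `φ`:
`d/ds α(dφ_s v) = dα(dφ_t/dt, dφ_t v) + d(α(dφ_t/dt))(v)`. -/
theorem ContactForm.hasDerivWithinAt_form_mfderiv (α : ContactForm d V)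
    (hφ : ContMDiff ((𝓡∂ 1).prod (𝓡 d)) (𝓡 d) ∞ (fun q : unitInterval × V => φ q.1 q.2))
    (t : unitInterval) (x : V) (v : TangentSpace (𝓡 d) x) :
    HasDerivWithinAt
      (fun s : ℝ => (α.form (φ (projIcc 0 1 zero_le_one s) x)
        (mfderiv (𝓡 d) (𝓡 d) (φ (projIcc 0 1 zero_le_one s)) x v) : ℝ))
      (extDerivForm α.form (φ t x) (velocity φ t x) (mfderiv (𝓡 d) (𝓡 d) (φ t) x v) +
        differential (fun z => (α.form (φ t z) (velocity φ t z) : ℝ)) x v) (Icc 0 1) t :=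
  α.hasDerivWithinAt_form_mfderiv_chart hφ t x (mem_extChartAt_target x)
    (mfderiv (𝓡 d) 𝓘(ℝ, EuclideanSpace ℝ (Fin d)) (extChartAt (𝓡 d) x) x v)
    ((extChartAt (𝓡 d) x).left_inv (mem_extChartAt_source x)).symm
    (mfderiv_extChartAt_symm_apply_mfderiv (mem_extChartAt_source x) v).symm

end Cartan

/-! ### Hamiltonians of contact isotopies -/

section Hamiltonians

variable {d : ℕ} {V : Type*} [TopologicalSpace V] [ChartedSpace (EuclideanSpace ℝ (Fin d)) V]
  [IsManifold (𝓡 d) ∞ V] (α : ContactForm d V)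

omit [IsManifold (𝓡 d) ∞ V] in
theorem mfderiv_injective_of_leftInverse {f g : V → V} (hf : ContMDiff (𝓡 d) (𝓡 d) ∞ f)
    (hg : ContMDiff (𝓡 d) (𝓡 d) ∞ g) (h : Function.LeftInverse g f) (x : V) :
    Function.Injective (mfderiv (𝓡 d) (𝓡 d) f x) := by
  have h1 := mfderiv_comp (I := 𝓡 d) (I' := 𝓡 d) (I'' := 𝓡 d) x
    (hg.mdifferentiableAt (x := f x) (by simp)) (hf.mdifferentiableAt (by simp))
  have h2 : g ∘ f = fun z => z := funext h
  have h3 : mfderiv (𝓡 d) (𝓡 d) (fun z : V => z) x = ContinuousLinearMap.id ℝ _ := mfderiv_id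
  rw [h2, h3] at h1
  intro u v huv
  have h4 : ∀ u : TangentSpace (𝓡 d) x, (u : EuclideanSpace ℝ (Fin d)) =
      mfderiv (𝓡 d) (𝓡 d) g (f x) (mfderiv (𝓡 d) (𝓡 d) f x u) :=
    fun u => congrArg (fun A => A u) h1
  exact (h4 u).trans ((congrArg _ huv).trans (h4 v).symm)

namespace contactIsotopy

variable {α} (φ : contactIsotopy α.ker)

theorem contMDiff_uncurry : ContMDiff ((𝓡∂ 1).prod (𝓡 d)) (𝓡 d) ∞
    (fun q : unitInterval × V => φ.1 q.1 q.2) := φ.2.1.1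

theorem contMDiff_uncurry_inv : ContMDiff ((𝓡∂ 1).prod (𝓡 d)) (𝓡 d) ∞
    (fun q : unitInterval × V => (φ.1 q.1)⁻¹ q.2) := φ.2.1.2.1

theorem apply_zero : φ.1 0 = 1 := φ.2.2

theorem contMDiff_apply (t : unitInterval) : ContMDiff (𝓡 d) (𝓡 d) ∞ (φ.1 t) :=
  (contMDiff_uncurry φ).comp (contMDiff_const.prodMk contMDiff_id)

theorem contMDiff_inv_apply (t : unitInterval) : ContMDiff (𝓡 d) (𝓡 d) ∞ ⇑(φ.1 t)⁻¹ :=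
  (contMDiff_uncurry_inv φ).comp (contMDiff_const.prodMk contMDiff_id)

theorem mfderiv_injective (t : unitInterval) (x : V) :
    Function.Injective (mfderiv (𝓡 d) (𝓡 d) (φ.1 t) x) :=
  mfderiv_injective_of_leftInverse (contMDiff_apply φ t) (contMDiff_inv_apply φ t)
    (fun y => by simp) x

theorem form_mfderiv_eq_zero (t : unitInterval) {x : V} {u : TangentSpace (𝓡 d) x}
    (hu : α.form x u = 0) : α.form (φ.1 t x) (mfderiv (𝓡 d) (𝓡 d) (φ.1 t) x u) = 0 := by
  have h : mfderiv (𝓡 d) (𝓡 d) (φ.1 t) x u ∈ α.ker (φ.1 t x) :=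
    (φ.2.1.2.2 t x).le ⟨u, hu, rfl⟩
  exact h

theorem exists_mfderiv_eq (t : unitInterval) {x : V} {w : TangentSpace (𝓡 d) (φ.1 t x)}
    (hw : α.form (φ.1 t x) w = 0) :
    ∃ u : TangentSpace (𝓡 d) x, α.form x u = 0 ∧ mfderiv (𝓡 d) (𝓡 d) (φ.1 t) x u = w := by
  have h : w ∈ (α.ker x).map (mfderiv (𝓡 d) (𝓡 d) (φ.1 t) x).toLinearMap :=
    (φ.2.1.2.2 t x).ge hw
  obtain ⟨u, hu, h⟩ := h
  exact ⟨u, hu, h⟩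

/-- The value `α(dφ_t/dt)` at `(t, x)`, the point being taken before the isotopy is applied. -/
noncomputable def formVelocity (t : unitInterval) (x : V) : ℝ :=
  α.form (φ.1 t x) (isotopyVelocity φ.1 t x)

/-- The contact Hamiltonian of a contact isotopy, `h_t (φ_t x) = α(dφ_t(x)/dt)`. -/
noncomputable def hamiltonian (t : unitInterval) (y : V) : ℝ :=
  formVelocity φ t ((φ.1 t)⁻¹ y)

theorem hamiltonian_apply (t : unitInterval) (x : V) :
    hamiltonian φ t (φ.1 t x) = formVelocity φ t x := by
  simp [hamiltonian]

theorem contMDiff_formVelocity : ContMDiff ((𝓡∂ 1).prod (𝓡 d)) 𝓘(ℝ, ℝ) ∞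
    (fun q : unitInterval × V => formVelocity φ q.1 q.2) :=
  α.contMDiff_form_velocity (φ := fun t => ⇑(φ.1 t)) (contMDiff_uncurry φ)

theorem contMDiff_hamiltonian : ContMDiff ((𝓡∂ 1).prod (𝓡 d)) 𝓘(ℝ, ℝ) ∞
    (fun q : unitInterval × V => hamiltonian φ q.1 q.2) :=
  (contMDiff_formVelocity φ).comp (contMDiff_fst.prodMk (contMDiff_uncurry_inv φ))

theorem hamiltonian_eq_of_generates {h : unitInterval → V → ℝ} (hφ : α.Generates h φ) :
    hamiltonian φ = h := by
  funext t y
  obtain ⟨x, rfl⟩ := (φ.1 t).surjective y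
  obtain ⟨r, -, h1, -⟩ := hφ t x
  exact (hamiltonian_apply φ t x).trans h1

/-- A contact isotopy integrates the contact vector field of its Hamiltonian. For `u` in `ξ` the
function `α(dφ_s u)` vanishes identically, so Cartan's formula gives
`dα(dφ_t/dt, w) = -dh(w)` for `w = dφ_t u` in `ξ`. -/
theorem generates_hamiltonian : α.Generates (hamiltonian φ) φ := by
  intro t x
  refine α.isContactVectorAt_of_ker (hamiltonian_apply φ t x).symm fun w hw => ?_
  obtain ⟨u, hu, rfl⟩ := exists_mfderiv_eq φ t hw
  have h1 := α.hasDerivWithinAt_form_mfderiv (φ := fun t => ⇑(φ.1 t)) (contMDiff_uncurry φ) t x u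
  have h2 := (hasDerivWithinAt_const (t : ℝ) (Icc (0 : ℝ) 1) (0 : ℝ)).congr_of_mem
    (fun s _ => form_mfderiv_eq_zero φ (projIcc 0 1 zero_le_one s) hu) t.2
  have h3 := (uniqueDiffOn_Icc (one_pos (α := ℝ)) t t.2).eq_deriv _ h1 h2
  have h4 : differential (formVelocity φ t) x u =
      differential (hamiltonian φ t) (φ.1 t x) (mfderiv (𝓡 d) (𝓡 d) (φ.1 t) x u) := by
    have h5 : formVelocity φ t = hamiltonian φ t ∘ φ.1 t :=
      funext fun z => (hamiltonian_apply φ t z).symm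
    have h6 : ContMDiff (𝓡 d) 𝓘(ℝ, ℝ) ∞ (hamiltonian φ t) :=
      (contMDiff_hamiltonian φ).comp (contMDiff_const.prodMk contMDiff_id)
    have h7 := mfderiv_comp (I := 𝓡 d) (I' := 𝓡 d) (I'' := 𝓘(ℝ, ℝ)) x
      (h6.mdifferentiableAt (x := φ.1 t x) (by simp))
      ((contMDiff_apply φ t).mdifferentiableAt (by simp))
    rw [h5]
    exact congrArg (fun A => A u) h7
  have h8 : extDerivForm α.form (φ.1 t x) (isotopyVelocity φ.1 t x)
      (mfderiv (𝓡 d) (𝓡 d) (φ.1 t) x u) + differential (formVelocity φ t) x u = 0 := h3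
  rw [h4] at h8
  linarith

/-- The conformal factor `λ_t` of a contact isotopy, `φ_t^* α = λ_t α`. -/
noncomputable def conformalFactor (t : unitInterval) (x : V) : ℝ :=
  α.form (φ.1 t x) (mfderiv (𝓡 d) (𝓡 d) (φ.1 t) x (α.reeb x))

theorem form_mfderiv (t : unitInterval) (x : V) (v : TangentSpace (𝓡 d) x) :
    α.form (φ.1 t x) (mfderiv (𝓡 d) (𝓡 d) (φ.1 t) x v) =
      conformalFactor φ t x * α.form x v := by
  have h := form_mfderiv_eq_zero φ t (u := v - α.form x v • α.reeb x) (x := x) (by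
    rw [map_sub, map_smul, α.form_reeb, smul_eq_mul, mul_one, sub_self])
  rw [map_sub, map_smul, map_sub, map_smul, smul_eq_mul, sub_eq_zero] at h
  rw [h, mul_comm]
  rfl

theorem continuous_conformalFactor :
    Continuous (fun q : unitInterval × V => conformalFactor φ q.1 q.2) :=
  (α.contMDiff_form_mfderiv (φ := fun t => ⇑(φ.1 t)) (contMDiff_uncurry φ)
    α.contMDiff_reeb).continuous

theorem conformalFactor_ne_zero (t : unitInterval) (x : V) : conformalFactor φ t x ≠ 0 := by
  intro h
  obtain ⟨u, hu, h1⟩ := exists_mfderiv_eq φ t h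
  have h2 := mfderiv_injective φ t x h1
  rw [h2, α.form_reeb] at hu
  exact one_ne_zero hu

theorem conformalFactor_zero (x : V) : conformalFactor φ 0 x = 1 := by
  have h1 : (⇑(φ.1 0) : V → V) = fun z => z := by rw [apply_zero φ]; rfl
  have h3 : mfderiv (𝓡 d) (𝓡 d) (fun z : V => z) x = ContinuousLinearMap.id ℝ _ := mfderiv_id
  have h2 : (mfderiv (𝓡 d) (𝓡 d) (φ.1 0) x (α.reeb x) : EuclideanSpace ℝ (Fin d)) =
      α.reeb x := by
    rw [h1, h3]; rfl
  exact (α.form_congr (congrFun h1 x) h2).trans (α.form_reeb x)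

theorem conformalFactor_pos (t : unitInterval) (x : V) : 0 < conformalFactor φ t x := by
  by_contra hneg
  have hc : Continuous (fun s => conformalFactor φ s x) :=
    (continuous_conformalFactor φ).comp (continuous_id.prodMk continuous_const)
  obtain ⟨s, hs⟩ := mem_range_of_exists_le_of_exists_ge hc ⟨t, not_lt.1 hneg⟩
    ⟨0, (conformalFactor_zero φ x).symm ▸ zero_le_one⟩
  exact conformalFactor_ne_zero φ s x hs

/-- The Hamiltonian of `χ = φ⁻¹ ψ`, for contact isotopies `φ` and `ψ` with Hamiltonians `f` and
`g`: it is `(g - f) ∘ φ_t` divided by the conformal factor of `φ`. -/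
theorem hamiltonian_inv_mul (φ ψ : contactIsotopy α.ker) (t : unitInterval) (x : V) :
    conformalFactor φ t ((φ⁻¹ * ψ).1 t x) * hamiltonian (φ⁻¹ * ψ) t ((φ⁻¹ * ψ).1 t x) =
      hamiltonian ψ t (ψ.1 t x) - hamiltonian φ t (ψ.1 t x) := by
  set χ := φ⁻¹ * ψ with hχ
  have hcomp : ∀ s y, φ.1 s (χ.1 s y) = ψ.1 s y := fun s y => by
    have : χ.1 s = (φ.1 s)⁻¹ * ψ.1 s := rfl
    rw [this, Equiv.Perm.mul_apply]; simp
  have hcurve : MDifferentiableAt (𝓡∂ 1) (𝓡 d) (fun s => χ.1 s x) t :=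
    ((contMDiff_uncurry χ).comp (contMDiff_id.prodMk contMDiff_const)).mdifferentiableAt (by simp)
  have hvel : (isotopyVelocity ψ.1 t x : EuclideanSpace ℝ (Fin d)) =
      isotopyVelocity φ.1 t (χ.1 t x) +
        mfderiv (𝓡 d) (𝓡 d) (φ.1 t) (χ.1 t x) (isotopyVelocity χ.1 t x) := by
    have h1 : (fun s => ψ.1 s x) =
        (fun q : unitInterval × V => φ.1 q.1 q.2) ∘ fun s => (s, χ.1 s x) :=
      funext fun s => (hcomp s x).symm
    have h2 := ((contMDiff_uncurry φ).mdifferentiableAt (x := (t, χ.1 t x))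
      (by simp)).hasMFDerivAt.comp t ((hasMFDerivAt_id t).prodMk hcurve.hasMFDerivAt)
    have h3 := congrArg (fun A => A (1 : TangentSpace (𝓡∂ 1) t)) h2.mfderiv
    have h4 := mfderiv_uncurry_apply (φ := fun t => ⇑(φ.1 t)) (contMDiff_uncurry φ) t (χ.1 t x) 1
      (isotopyVelocity χ.1 t x)
    have h5 : (isotopyVelocity ψ.1 t x : EuclideanSpace ℝ (Fin d)) =
        mfderiv (𝓡∂ 1) (𝓡 d) ((fun q : unitInterval × V => φ.1 q.1 q.2) ∘ fun s => (s, χ.1 s x)) t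
          (1 : TangentSpace (𝓡∂ 1) t) := by
      rw [← h1]; rfl
    exact h5.trans (h3.trans h4)
  have h6 : formVelocity ψ t x = formVelocity φ t (χ.1 t x) +
      conformalFactor φ t (χ.1 t x) * formVelocity χ t x := by
    have h7 := α.form_congr (hcomp t x).symm hvel
    refine h7.trans ?_
    have h8 := form_mfderiv φ t (χ.1 t x) (isotopyVelocity χ.1 t x)
    refine ((α.form (φ.1 t (χ.1 t x))).map_add _ _).trans ?_
    rw [h8]
    rfl
  rw [hamiltonian_apply χ, hamiltonian_apply ψ, h6, ← hamiltonian_apply φ, hcomp]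
  ring

end contactIsotopy

/-- If the Hamiltonians of two contact isotopies satisfy `f ≤ g`, then so do the values of a
monotone function on their classes. -/
theorem ContactForm.IsMonotone.le_of_hamiltonian_le {α : ContactForm d V}
    {μ : ContTilde α.ker → ℝ} (hμ : α.IsMonotone μ) (φ ψ : contactIsotopy α.ker)
    (h : ∀ t y, contactIsotopy.hamiltonian φ t y ≤ contactIsotopy.hamiltonian ψ t y) :
    μ (φ : ContTilde α.ker) ≤ μ (ψ : ContTilde α.ker) := by
  refine hμ _ _ ⟨contactIsotopy.hamiltonian (φ⁻¹ * ψ),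
    contactIsotopy.contMDiff_hamiltonian (φ⁻¹ * ψ), fun t y => ?_,
    φ⁻¹ * ψ, contactIsotopy.generates_hamiltonian (φ⁻¹ * ψ), rfl⟩
  obtain ⟨x, rfl⟩ := ((φ⁻¹ * ψ).1 t).surjective y
  have h1 := contactIsotopy.hamiltonian_inv_mul φ ψ t x
  have h2 : 0 ≤ contactIsotopy.conformalFactor φ t ((φ⁻¹ * ψ).1 t x) *
      contactIsotopy.hamiltonian (φ⁻¹ * ψ) t ((φ⁻¹ * ψ).1 t x) := by
    rw [h1]; exact sub_nonneg.2 (h _ _)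
  exact nonneg_of_mul_nonneg_right h2 (contactIsotopy.conformalFactor_pos φ _ _)

end Hamiltonians

/-! ### Flows of contact vector fields -/

section ContactFlows

variable {d : ℕ} {V : Type*} [TopologicalSpace V] [ChartedSpace (EuclideanSpace ℝ (Fin d)) V]

theorem mfderiv_comp_unitInterval_val {γ : ℝ → V} {t : unitInterval}
    {v : TangentSpace (𝓡 d) (γ t)}
    (h : HasMFDerivAt 𝓘(ℝ, ℝ) (𝓡 d) γ (t : ℝ) ((1 : ℝ →L[ℝ] ℝ).smulRight v)) :
    mfderiv (𝓡∂ 1) (𝓡 d) (fun s : unitInterval => γ s) t (1 : TangentSpace (𝓡∂ 1) t) = v := by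
  have h1 : HasMFDerivAt (𝓡∂ 1) 𝓘(ℝ, ℝ) (fun s : unitInterval => (s : ℝ)) t _ :=
    ((contMDiff_subtypeVal_Icc (n := 1)).mdifferentiableAt one_ne_zero).hasMFDerivAt
  have h2 := congrArg (fun A => A (1 : TangentSpace (𝓡∂ 1) t)) (h.comp t h1).mfderiv
  have h3 := mfderiv_subtypeVal_Icc_one (x := 0) (y := 1) t
  refine h2.trans
    ((congrArg ((1 : ℝ →L[ℝ] ℝ).smulRight (v : EuclideanSpace ℝ (Fin d))) h3).trans ?_)
  exact one_smul ℝ (v : EuclideanSpace ℝ (Fin d))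

variable [IsManifold (𝓡 d) ∞ V] {α : ContactForm d V} {f : V → ℝ}
  {θ : Multiplicative ℝ →* Equiv.Perm V}

theorem ContactForm.form_contactField (α : ContactForm d V) (f : V → ℝ) (x : V) :
    α.form x (α.contactField f x) = f x := by
  obtain ⟨r, -, h, -⟩ := α.isContactVectorAt_contactField f x
  exact h

theorem velocity_flow (hint : ∀ x, IsMIntegralCurve (I := 𝓡 d) (fun t => θ (.ofAdd t) x)
    (α.contactField f)) (r : ℝ) (t : unitInterval) (x : V) :
    velocity (fun s : unitInterval => ⇑(θ (.ofAdd (s * r)))) t x =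
      r • α.contactField f (θ (.ofAdd (t * r)) x) :=
  mfderiv_comp_unitInterval_val (γ := fun s => θ (.ofAdd (s * r)) x)
    (((hint x).comp_mul r) t)

omit [IsManifold (𝓡 d) ∞ V] in
theorem contMDiff_flow (hθ : ContMDiff (𝓘(ℝ, ℝ).prod (𝓡 d)) (𝓡 d) ∞
      (fun q : ℝ × V => θ (.ofAdd q.1) q.2)) (r : ℝ) :
    ContMDiff ((𝓡∂ 1).prod (𝓡 d)) (𝓡 d) ∞
      (fun q : unitInterval × V => θ (.ofAdd (q.1 * r)) q.2) := by
  refine hθ.comp (ContMDiff.prodMk ?_ contMDiff_snd)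
  have h : ContMDiff 𝓘(ℝ, ℝ) 𝓘(ℝ, ℝ) ∞ (fun s : ℝ => s * r) :=
    (contDiff_id.mul contDiff_const).contMDiff
  exact h.comp (contMDiff_subtypeVal_Icc.comp contMDiff_fst)

/-- The flow of the contact vector field of `f` preserves `ξ`: for `u` in `ξ`, Cartan's formula
shows that `A(s) = α(dθ_s u)` solves the linear equation `A' = df(R) A`. -/
theorem form_mfderiv_flow_eq_zero [CompactSpace V] (hf : ContMDiff (𝓡 d) 𝓘(ℝ, ℝ) ∞ f)
    (hθ : ContMDiff (𝓘(ℝ, ℝ).prod (𝓡 d)) (𝓡 d) ∞ (fun q : ℝ × V => θ (.ofAdd q.1) q.2))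
    (hint : ∀ x, IsMIntegralCurve (I := 𝓡 d) (fun t => θ (.ofAdd t) x) (α.contactField f))
    (r : ℝ) {x : V} {u : TangentSpace (𝓡 d) x} (hu : α.form x u = 0) :
    α.form (θ (.ofAdd r) x) (mfderiv (𝓡 d) (𝓡 d) (θ (.ofAdd r)) x u) = 0 := by
  set φ : unitInterval → V → V := fun s => ⇑(θ (.ofAdd (s * r))) with hφdef
  have hφ : ContMDiff ((𝓡∂ 1).prod (𝓡 d)) (𝓡 d) ∞ (fun q : unitInterval × V => φ q.1 q.2) :=
    contMDiff_flow hθ r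
  set A : ℝ → ℝ := fun s => α.form (φ (projIcc 0 1 zero_le_one s) x)
    (mfderiv (𝓡 d) (𝓡 d) (φ (projIcc 0 1 zero_le_one s)) x u) with hA
  set g : V → ℝ := fun y => differential f y (α.reeb y) with hg
  have hderiv : ∀ t : unitInterval, HasDerivWithinAt A (r * g (φ t x) * A t) (Icc 0 1) t := by
    intro t
    refine (α.hasDerivWithinAt_form_mfderiv hφ t x u).congr_deriv ?_
    have hAt : A t = α.form (φ t x) (mfderiv (𝓡 d) (𝓡 d) (φ t) x u) := by
      have hp : projIcc 0 1 zero_le_one (t : ℝ) = t := projIcc_val _ _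
      simp only [hA]
      rw [hp]
    have h1 : (fun z => (α.form (φ t z) (velocity φ t z) : ℝ)) = fun z => r * f (φ t z) := by
      funext z
      have := velocity_flow hint r t z
      refine (congrArg (α.form (φ t z)) this).trans ?_
      refine ((α.form (φ t z)).map_smul r _).trans ?_
      exact congrArg (r * ·) (α.form_contactField f _)
    have hd : ContMDiff (𝓡 d) (𝓡 d) ∞ (φ t) := hφ.comp (contMDiff_const.prodMk contMDiff_id)
    have h2 : differential (fun z => r * f (φ t z)) x u =
        r * differential f (φ t x) (mfderiv (𝓡 d) (𝓡 d) (φ t) x u) := by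
      have h3 := (((hf.mdifferentiableAt (x := φ t x) (by simp)).hasMFDerivAt.comp x
        (hd.mdifferentiableAt (by simp)).hasMFDerivAt).const_smul r).mfderiv
      exact congrArg (fun B => B u) h3
    have h4 : ∀ w, extDerivForm α.form (φ t x) (velocity φ t x) w =
        r * (g (φ t x) * α.form (φ t x) w - differential f (φ t x) w) := by
      intro w
      rw [velocity_flow hint r t x, α.extDerivForm_eq, map_smul, map_smul, LinearMap.smul_apply]
      have h5 := α.pairing_contactField f (φ t x) w
      rw [α.hamiltonianForm_apply] at h5
      have h6 := α.form_contactField f (φ t x)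
      have h7 : α.pairing (θ (.ofAdd (t * r)) x) (α.contactField f (θ (.ofAdd (t * r)) x)) w = _ :=
        h5
      have h8 : α.form (θ (.ofAdd (t * r)) x) (α.contactField f (θ (.ofAdd (t * r)) x)) = _ := h6
      rw [h7, h8, smul_eq_mul, smul_eq_mul]
      change r * ((f (φ t x) + g (φ t x)) * α.form (φ t x) w - differential f (φ t x) w) -
        r * f (φ t x) * α.form (φ t x) w = _
      ring
    rw [h4, h1, h2, hAt]
    ring
  obtain ⟨C, hC⟩ := isCompact_univ.exists_bound_of_continuousOn
    (contMDiff_differential_apply hf α.contMDiff_reeb).continuous.continuousOn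
  have hA0 : A 0 = 0 := by
    have h0 : φ (projIcc 0 1 zero_le_one 0) = fun z => z := by
      simp only [hφdef, projIcc_left, zero_mul, ofAdd_zero, map_one]
      rfl
    have h3 : mfderiv (𝓡 d) (𝓡 d) (fun z : V => z) x = ContinuousLinearMap.id ℝ _ := mfderiv_id
    have h2 : (mfderiv (𝓡 d) (𝓡 d) (φ (projIcc 0 1 zero_le_one 0)) x u :
        EuclideanSpace ℝ (Fin d)) = u := by
      rw [h0, h3]; rfl
    exact (α.form_congr (congrFun h0 x) h2).trans hu
  have hA1 : A 1 = 0 := by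
    refine eq_zero_of_abs_deriv_le_mul_abs_self_of_eq_zero_right (f := A) (a := 0) (b := 1)
      (K := |r| * C) (f' := fun s => r * g (φ (projIcc 0 1 zero_le_one s) x) * A s)
      (fun s hs => (hderiv ⟨s, hs⟩).continuousWithinAt) (fun s hs => ?_) hA0 (fun s _ => ?_) 1
      (right_mem_Icc.2 zero_le_one)
    · have h1 := hderiv ⟨s, Ico_subset_Icc_self hs⟩
      rw [← projIcc_of_mem zero_le_one (Ico_subset_Icc_self hs)] at h1
      rw [projIcc_of_mem zero_le_one (Ico_subset_Icc_self hs)] at h1 ⊢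
      exact h1.mono_of_mem_nhdsWithin (Icc_mem_nhdsGE_of_mem hs)
    · rw [norm_mul, norm_mul, Real.norm_eq_abs r]
      gcongr
      exact hC _ (mem_univ _)
  have h1 : φ (projIcc 0 1 zero_le_one 1) = ⇑(θ (.ofAdd r)) := by
    simp only [hφdef, projIcc_right, one_mul]
  have h2 : (mfderiv (𝓡 d) (𝓡 d) (φ (projIcc 0 1 zero_le_one 1)) x u :
      EuclideanSpace ℝ (Fin d)) = mfderiv (𝓡 d) (𝓡 d) (θ (.ofAdd r)) x u := by
    rw [h1]
  exact (α.form_congr (congrFun h1 x) h2).symm.trans hA1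

/-- On a closed manifold the flow of the contact vector field of `f` is a contact isotopy. Its
`k`-th power is the flow of `k f`. -/
theorem ContactForm.exists_contactIsotopy_zpow_hamiltonian [CompactSpace V] [T2Space V]
    (α : ContactForm d V) (hf : ContMDiff (𝓡 d) 𝓘(ℝ, ℝ) ∞ f) :
    ∃ φ : contactIsotopy α.ker, ∀ k : ℤ,
      contactIsotopy.hamiltonian (φ ^ k) = fun _ y => k * f y := by
  obtain ⟨θ, hθ, hint⟩ := exists_flow (α.contMDiff_contactField hf)
  have hd : ∀ r, ContMDiff (𝓡 d) (𝓡 d) ∞ (θ (.ofAdd r)) := fun r =>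
    hθ.comp (contMDiff_const.prodMk contMDiff_id)
  have hinv : ∀ r : ℝ, (θ (.ofAdd r))⁻¹ = θ (.ofAdd (-r)) := fun r => by
    rw [ofAdd_neg, map_inv]
  have hli : ∀ r : ℝ, Function.LeftInverse (θ (.ofAdd (-r))) (θ (.ofAdd r)) := fun r y => by
    rw [← hinv]; simp
  have hker : ∀ (r : ℝ) (x : V), (α.ker x).map (mfderiv (𝓡 d) (𝓡 d) (θ (.ofAdd r)) x).toLinearMap =
      α.ker (θ (.ofAdd r) x) := by
    intro r x
    refine le_antisymm ?_ fun w hw => ?_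
    · rintro _ ⟨u, hu, rfl⟩
      exact form_mfderiv_flow_eq_zero hf hθ hint r hu
    · have hinj := mfderiv_injective_of_leftInverse (hd r) (hd (-r)) (hli r) x
      have hsurj : Function.Surjective (mfderiv (𝓡 d) (𝓡 d) (θ (.ofAdd r)) x) := by
        let L : EuclideanSpace ℝ (Fin d) →L[ℝ] EuclideanSpace ℝ (Fin d) :=
          mfderiv (𝓡 d) (𝓡 d) (θ (.ofAdd r)) x
        exact (LinearMap.injective_iff_surjective (f := L.toLinearMap)).1 hinj
      obtain ⟨u, rfl⟩ := hsurj w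
      refine ⟨u, ?_, rfl⟩
      have h1 := form_mfderiv_flow_eq_zero hf hθ hint (-r) hw
      have h2 := mfderiv_comp (I := 𝓡 d) (I' := 𝓡 d) (I'' := 𝓡 d) x
        ((hd (-r)).mdifferentiableAt (x := θ (.ofAdd r) x) (by simp))
        ((hd r).mdifferentiableAt (by simp))
      have h3 : θ (.ofAdd (-r)) ∘ θ (.ofAdd r) = fun z => z := funext (hli r)
      have h4 : mfderiv (𝓡 d) (𝓡 d) (fun z : V => z) x = ContinuousLinearMap.id ℝ _ := mfderiv_id
      rw [h3, h4] at h2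
      exact (α.form_congr (hli r x) (congrArg (fun A => A u) h2).symm).symm.trans h1
  obtain ⟨φ, hφ⟩ : ∃ φ : contactIsotopy α.ker, ∀ t, φ.1 t = θ (.ofAdd (t : ℝ)) := by
    refine ⟨⟨fun t => θ (.ofAdd (t : ℝ)), ⟨?_, ?_, fun t x => hker t x⟩, ?_⟩, fun t => rfl⟩
    · simpa only [mul_one] using contMDiff_flow hθ 1
    · simpa only [hinv, mul_neg, mul_one] using contMDiff_flow hθ (-1)
    · change θ (.ofAdd (0 : ℝ)) = 1
      rw [ofAdd_zero, map_one]
  refine ⟨φ, fun k => ?_⟩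
  funext t y
  obtain ⟨x, rfl⟩ := ((φ ^ k).1 t).surjective y
  rw [contactIsotopy.hamiltonian_apply]
  have h1 : (φ ^ k).1 = fun t : unitInterval => θ (.ofAdd (t * k)) := by
    funext t
    have h2 : (φ ^ k).1 t = φ.1 t ^ k := rfl
    rw [h2, hφ, ← map_zpow, ← ofAdd_zsmul, zsmul_eq_mul, mul_comm]
  change α.form ((φ ^ k).1 t x) (isotopyVelocity (φ ^ k).1 t x) = _
  rw [h1]
  refine (congrArg (α.form (θ (.ofAdd (t * k)) x)) (velocity_flow hint k t x)).trans ?_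
  refine ((α.form (θ (.ofAdd (t * k)) x)).map_smul (k : ℝ) _).trans ?_
  exact congrArg ((k : ℝ) * ·) (α.form_contactField f _)

theorem ContactForm.exists_contactIsotopy_hamiltonian [CompactSpace V] [T2Space V]
    (α : ContactForm d V) (hf : ContMDiff (𝓡 d) 𝓘(ℝ, ℝ) ∞ f) :
    ∃ φ : contactIsotopy α.ker, contactIsotopy.hamiltonian φ = fun _ => f := by
  obtain ⟨φ, hφ⟩ := α.exists_contactIsotopy_zpow_hamiltonian hf
  refine ⟨φ, ?_⟩
  simpa using hφ 1

end ContactFlows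

/-! ### Superheavy and subheavy sets -/

section HeavySets

variable {d : ℕ} {V : Type*} [TopologicalSpace V] [ChartedSpace (EuclideanSpace ℝ (Fin d)) V]
  [IsManifold (𝓡 d) ∞ V] [CompactSpace V] [T2Space V] {α : ContactForm d V}
  {μ : ContTilde α.ker → ℝ}

omit [CompactSpace V] [T2Space V] in
theorem ContactForm.represents_of_hamiltonian_eq {h : V → ℝ} {φ : contactIsotopy α.ker}
    (hφ : contactIsotopy.hamiltonian φ = fun _ => h) :
    α.Represents (fun _ => h) (φ : ContTilde α.ker) :=
  ⟨φ, hφ ▸ contactIsotopy.generates_hamiltonian φ, rfl⟩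

/-- For `h` vanishing on a superheavy set, with flow `φ`, the values `μ(φ^k)` are bounded below
uniformly in `k`. Indeed `k h + δ` is positive on the set for every `δ > 0`, and for small `δ` its
flow is `φ^k` followed by an isotopy whose Hamiltonian is at most `1`. -/
theorem ContactForm.IsSuperheavy.exists_lt_zpow [Nonempty V] (hμ : IsQuasiMorphism μ)
    (hmono : α.IsMonotone μ) {Y : Set V} (hY : α.IsSuperheavy μ Y) {h : V → ℝ}
    (hh : ContMDiff (𝓡 d) 𝓘(ℝ, ℝ) ∞ h) (hhY : ∀ y ∈ Y, h y = 0) {φ : contactIsotopy α.ker}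
    (hφ : ∀ k : ℤ, contactIsotopy.hamiltonian (φ ^ k) = fun _ y => k * h y) :
    ∃ C : ℝ, ∀ k : ℤ, -C < μ ((φ : ContTilde α.ker) ^ k) := by
  obtain ⟨D, -, hD⟩ := hμ.bounded_defect
  obtain ⟨ρ, hρ⟩ := α.exists_contactIsotopy_hamiltonian (f := fun _ => (1 : ℝ)) contMDiff_const
  refine ⟨μ (ρ : ContTilde α.ker) + D, fun k => ?_⟩
  -- `δ` is the minimum of the conformal factor of `φ ^ k`
  obtain ⟨⟨t₀, x₀⟩, -, hmin⟩ := isCompact_univ.exists_isMinOn univ_nonempty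
    (contactIsotopy.continuous_conformalFactor (φ ^ k)).continuousOn
  set δ := contactIsotopy.conformalFactor (φ ^ k) t₀ x₀ with hδ
  have hδ0 : 0 < δ := contactIsotopy.conformalFactor_pos (φ ^ k) t₀ x₀
  have hs : ContMDiff (𝓡 d) 𝓘(ℝ, ℝ) ∞ (fun y => k * h y + δ) :=
    (contMDiff_const.mul hh).add contMDiff_const
  obtain ⟨ψ, hψ⟩ := α.exists_contactIsotopy_hamiltonian hs
  have hpos : 0 < μ (ψ : ContTilde α.ker) :=
    hY.2 _ hs (fun y hy => by simpa [hhY y hy] using hδ0) _ (represents_of_hamiltonian_eq hψ)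
  have hle : μ ((φ ^ k)⁻¹ * ψ : contactIsotopy α.ker) ≤ μ (ρ : ContTilde α.ker) := by
    refine hmono.le_of_hamiltonian_le _ _ fun t y => ?_
    obtain ⟨x, rfl⟩ := (((φ ^ k)⁻¹ * ψ).1 t).surjective y
    have h1 := contactIsotopy.hamiltonian_inv_mul (φ ^ k) ψ t x
    have h2 := hmin (mem_univ (t, ((φ ^ k)⁻¹ * ψ).1 t x))
    rw [hφ, hψ, add_sub_cancel_left] at h1
    rw [hρ]
    refine le_of_mul_le_mul_left ?_
      (contactIsotopy.conformalFactor_pos (φ ^ k) t (((φ ^ k)⁻¹ * ψ).1 t x))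
    rw [h1, mul_one]
    exact h2
  have hquasi := (abs_le.1 (hD ((φ : ContTilde α.ker) ^ k)
    (((φ ^ k)⁻¹ * ψ : contactIsotopy α.ker) : ContTilde α.ker))).2
  have hprod : (φ : ContTilde α.ker) ^ k *
      (((φ ^ k)⁻¹ * ψ : contactIsotopy α.ker) : ContTilde α.ker) = ψ := by
    rw [QuotientGroup.mk_mul, QuotientGroup.mk_inv, QuotientGroup.mk_zpow, mul_inv_cancel_left]
  rw [hprod] at hquasi
  linarith

theorem ContactForm.IsSuperheavy.isSubheavy [Nonempty V] (hμ : IsQuasiMorphism μ)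
    (hmono : α.IsMonotone μ) {Y : Set V} (hY : α.IsSuperheavy μ Y) : α.IsSubheavy μ Y := by
  refine ⟨hY.1, ?_⟩
  rintro h hh hhY _ ⟨φ₀, hφ₀, rfl⟩
  obtain ⟨φ, hφ⟩ := α.exists_contactIsotopy_zpow_hamiltonian hh
  have heq : contactIsotopy.hamiltonian φ₀ = contactIsotopy.hamiltonian φ := by
    rw [contactIsotopy.hamiltonian_eq_of_generates φ₀ hφ₀]
    simpa using (hφ 1).symm
  have h1 : μ (φ₀ : ContTilde α.ker) = μ (φ : ContTilde α.ker) :=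
    le_antisymm (hmono.le_of_hamiltonian_le _ _ fun t y => by rw [heq])
      (hmono.le_of_hamiltonian_le _ _ fun t y => by rw [heq])
  rw [h1]
  obtain ⟨C, hC⟩ := hY.exists_lt_zpow hμ hmono hh hhY hφ
  simp only [hμ.homogeneous] at hC
  -- `-C < k * μ φ` for all integers `k`, of either sign
  rcases lt_trichotomy (μ (φ : ContTilde α.ker)) 0 with hneg | h0 | hpos
  · obtain ⟨k, hk⟩ := exists_nat_gt (C / -μ (φ : ContTilde α.ker))
    rw [div_lt_iff₀ (by linarith)] at hk
    have := hC k
    push_cast at this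
    linarith
  · exact h0
  · obtain ⟨k, hk⟩ := exists_nat_gt (C / μ (φ : ContTilde α.ker))
    rw [div_lt_iff₀ hpos] at hk
    have := hC (-k)
    push_cast at this
    linarith

/-- A superheavy set `Y` meets a subheavy set `Z`: otherwise a smooth function equal to `1` on `Y`
and `0` on `Z` generates an element where `μ` is both positive and zero. -/
theorem ContactForm.IsSuperheavy.inter_nonempty {Y Z : Set V} (hY : α.IsSuperheavy μ Y)
    (hZ : α.IsSubheavy μ Z) : (Y ∩ Z).Nonempty := by
  by_contra hne
  obtain ⟨f, hf0, hf1, -⟩ := exists_contMDiffMap_zero_one_of_isClosed (𝓡 d) (n := ⊤) hZ.1 hY.1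
    (disjoint_iff_inter_eq_empty.2 (by rw [inter_comm]; exact not_nonempty_iff_eq_empty.1 hne))
  obtain ⟨φ, hφ⟩ := α.exists_contactIsotopy_hamiltonian f.contMDiff
  have hrep := represents_of_hamiltonian_eq hφ
  have h1 := hY.2 f f.contMDiff (fun y hy => by rw [hf1 hy]; exact one_pos) _ hrep
  exact h1.ne' (hZ.2 f f.contMDiff (fun z hz => hf0 hz) _ hrep)

end HeavySets

theorem theoremt {n : ℕ} {V : Type*} [TopologicalSpace V]
    [ChartedSpace (EuclideanSpace ℝ (Fin (2 * n + 1))) V] [IsManifold (𝓡 (2 * n + 1)) ∞ V]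
    [T2Space V] [CompactSpace V] [ConnectedSpace V]
    (α : ContactForm (2 * n + 1) V) (μ : ContTilde α.ker → ℝ)
    (hμ : IsQuasiMorphism μ) (hmono : α.IsMonotone μ) :
    (∀ Y : Set V, α.IsSuperheavy μ Y → α.IsSubheavy μ Y) ∧
    (∀ Y Z : Set V, α.IsSuperheavy μ Y → α.IsSubheavy μ Z → (Y ∩ Z).Nonempty) :=
  ⟨fun _ hY => hY.isSubheavy hμ hmono, fun _ _ hY hZ => hY.inter_nonempty hZ⟩
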